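/- For a group $G$, let $\ell^1(G)^{**}$ be the second dual of the convolution Banach algebra $\ell^1(G)$, regarded as a Banach algebra with the first Arens product $\Box$, given by $\langle \Psi\Box\Phi,\lambda\rangle=\langle\Psi,\Phi\cdot\lambda\rangle$, $\langle a,\Phi\cdot\lambda\rangle=\langle\Phi,\lambda\cdot a\rangle$, $\langle b,\lambda\cdot a\rangle=\langle ab,\lambda\rangle$, and let $\operatorname{rad}\ell^1(G)^{**}$ be its Jacobson radical (the intersection of the maximal left ideals). An invariant difference on a group $H$ is an element $\Gamma\in\ell^1(H)^{**}$ with $\delta_s\Box\Gamma=\Gamma$ for all $s\in H$ and $\langle\Gamma,1\rangle=0$. Let $J_{sn}(G)$ be the linear span of all $\Phi\Box\Gamma$, where $\Phi\in\ell^1(G)^{**}$ and $\Gamma$ is an invariant difference on some subnormal subgroup $H$ of $G$ (with $\ell^1(H)^{**}\subset\ell^1(G)^{**}$ in the natural way). A group $G$ is a branch group if there are descending (not necessarily strictly) chains of subgroups $H_1\supseteq H_2\supseteq\cdots$ and $L_1\supseteq L_2\supseteq\cdots$ of $G$ and positive integers $k_1,k_2,\ldots$ such that (1) $\bigcap_i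 H_i=1$; (2) each $H_i$ is normal of finite index in $G$; (3) each $H_i$ is an internal direct product $L_i^{(1)}\times\cdots\times L_i^{(k_i)}$ of subgroups isomorphic to $L_i$; (4) $m_i:=k_{i+1}/k_i$ is an integer $\ge 2$, and $L_i^{(j)}$ contains $L_{i+1}^{(l)}$ for $(j-1)m_i<l\le jm_i$; (5) conjugation by elements of $G$ permutes $L_i^{(1)},\ldots,L_i^{(k_i)}$ transitively, for every $i$. The index of a nilpotent subalgebra $I$ is the least $n\ge 1$ with $I^{\Box n}=\{0\}$. **Theorem.** Let $G$ be an infinite amenable (discrete) branch group, and let $A$ be either $\ell^1(G)^{**}$ or $J_{sn}(G)$. Then $A$ contains nilpotent left ideals of arbitrarily large index; that is, for every $N$ there is a left ideal of $A$, which is moreover a left ideal of $\ell^1(G)^{**}$, that is nilpotent of index at least $N$. Consequently $\operatorname{rad}\ell^1(G)^{**}$ contains non-nilpotent elements, and in particular $(\operatorname{rad}\ell^1(G)^{**})^{\Box 2}\neq\{0\}$, so every such $G$ (in particular every finitely generated one) is a counterexample to the question of Dales and Lau, which asks whether $(\operatorname{rad}\ell^1(G)^{**})^{\Box 2}=\{0\}$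 for every group $G$. Moreover, finitely generated counterexamples exist: there is a finitely generated group $G$ such that $\operatorname{rad}\ell^1(G)^{**}$ contains non-nilpotent elements. -/

import Mathlib

open scoped ENNReal lp

noncomputable section

/-! ### The convolution algebra `ℓ¹(G)` -/

/-- The Banach space `ℓ¹(G)` of absolutely summable functions `G → ℂ`. -/
def Ell1 (G : Type*) : Type _ := lp (fun _ : G => ℂ) 1

namespace Ell1

section Space

variable {G : Type*}

instance : NormedAddCommGroup (Ell1 G) :=
  inferInstanceAs (NormedAddCommGroup (lp (fun _ : G => ℂ) 1))

instance : NormedSpace ℂ (Ell1 G) :=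
  inferInstanceAs (NormedSpace ℂ (lp (fun _ : G => ℂ) 1))

instance : CompleteSpace (Ell1 G) :=
  inferInstanceAs (CompleteSpace (lp (fun _ : G => ℂ) 1))

/-- An element of `ℓ¹(G)`, as an element of Mathlib's `lp` space. -/
abbrev toLp (f : Ell1 G) : lp (fun _ : G => ℂ) 1 := f

instance : CoeFun (Ell1 G) (fun _ => G → ℂ) where
  coe f := (toLp f : G → ℂ)

theorem ext {f g : Ell1 G} (h : ∀ t, f t = g t) : f = g :=
  lp.ext (funext h)

@[simp] theorem add_apply (f g : Ell1 G) (t : G) : (f + g) t = f t + g t := rfl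

@[simp] theorem smul_apply (c : ℂ) (f : Ell1 G) (t : G) : (c • f) t = c * f t := rfl

@[simp] theorem zero_apply (t : G) : (0 : Ell1 G) t = 0 := rfl

theorem summable_norm (f : Ell1 G) : Summable (fun t => ‖f t‖) := by
  have h := (lp.memℓp (toLp f)).summable (by simp)
  simpa using h

theorem norm_eq (f : Ell1 G) : ‖f‖ = ∑' t, ‖f t‖ := by
  have h := lp.norm_eq_tsum_rpow (p := 1) (by simp) (toLp f)
  simp only [ENNReal.toReal_one, Real.rpow_one, div_one] at h
  exact h

/-- An absolutely summable function, as an element of `ℓ¹(G)`. -/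
def mk (f : G → ℂ) (hf : Summable (fun t => ‖f t‖)) : Ell1 G :=
  (⟨f, memℓp_gen (by simpa using hf)⟩ : lp (fun _ : G => ℂ) 1)

@[simp] theorem mk_apply (f : G → ℂ) (hf : Summable (fun t => ‖f t‖)) (t : G) :
    mk f hf t = f t := rfl

open Classical in
/-- The point mass `δ_t`. -/
def delta (t : G) : Ell1 G :=
  (lp.single 1 t (1 : ℂ) : lp (fun _ : G => ℂ) 1)

open Classical in
theorem delta_apply (t u : G) : delta t u = if u = t then 1 else 0 := by
  change (lp.single 1 t (1 : ℂ) : lp (fun _ : G => ℂ) 1) u = _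
  rw [lp.single_apply]
  simp [Pi.single_apply]

open Classical in
/-- Continuous linear maps on `ℓ¹(G)` that agree on point masses are equal. -/
theorem clm_ext {E : Type*} [NormedAddCommGroup E] [NormedSpace ℂ E] {S T : Ell1 G →L[ℂ] E}
    (h : ∀ t, S (delta t) = T (delta t)) : S = T := by
  refine lp.ext_continuousLinearMap (𝕜 := ℂ) (E := fun _ : G => ℂ) (p := 1) (by simp) ?_
  intro t
  ext
  exact h t

/-- The functional `f ↦ ∑ f(t)`, that is, the constant function `1` regarded as an element of
`ℓ^∞(G) = ℓ¹(G)^*`. -/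
def sumCLM (G : Type*) : StrongDual ℂ (Ell1 G) :=
  LinearMap.mkContinuous
    { toFun := fun f => ∑' t, f t
      map_add' := fun f g =>
        (f.summable_norm.of_norm).tsum_add (g.summable_norm.of_norm)
      map_smul' := fun c f => by simp [tsum_mul_left] }
    1 (fun f => by
      rw [one_mul, norm_eq]
      exact norm_tsum_le_tsum_norm f.summable_norm)

@[simp] theorem sumCLM_apply (f : Ell1 G) : sumCLM G f = ∑' t, f t := rfl

end Space

section Algebra

variable {G : Type*} [Group G]

/-- The change of variables `(s, t) ↦ (s, s⁻¹ t)`. -/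
def shear (G : Type*) [Group G] : G × G ≃ G × G where
  toFun p := (p.1, p.1⁻¹ * p.2)
  invFun p := (p.1, p.1 * p.2)
  left_inv p := by simp
  right_inv p := by simp

theorem summable_conv (f g : Ell1 G) :
    Summable (fun p : G × G => ‖f p.1‖ * ‖g (p.1⁻¹ * p.2)‖) :=
  (shear G).summable_iff.2 (f.summable_norm.mul_of_nonneg g.summable_norm
    (fun _ => norm_nonneg _) (fun _ => norm_nonneg _))

theorem summable_conv_swap (f g : Ell1 G) :
    Summable (fun p : G × G => ‖f p.2‖ * ‖g (p.2⁻¹ * p.1)‖) :=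
  (Equiv.prodComm G G).summable_iff.2 (summable_conv f g)

theorem summable_conv_apply (f g : Ell1 G) (t : G) :
    Summable (fun s => ‖f s‖ * ‖g (s⁻¹ * t)‖) :=
  (summable_conv_swap f g).prod_factor t

theorem norm_conv_le (f g : Ell1 G) (t : G) :
    ‖∑' s, f s * g (s⁻¹ * t)‖ ≤ ∑' s, ‖f s‖ * ‖g (s⁻¹ * t)‖ := by
  have h : Summable (fun s => ‖f s * g (s⁻¹ * t)‖) := by
    simpa using summable_conv_apply f g t
  simpa using norm_tsum_le_tsum_norm h

theorem summable_conv_norm (f g : Ell1 G) :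
    Summable (fun t => ‖∑' s, f s * g (s⁻¹ * t)‖) :=
  Summable.of_nonneg_of_le (fun _ => norm_nonneg _) (norm_conv_le f g)
    (summable_conv_swap f g).prod

/-- Convolution `(f * g)(t) = ∑_s f(s) g(s⁻¹ t)`. -/
def conv (f g : Ell1 G) : Ell1 G :=
  mk (fun t => ∑' s, f s * g (s⁻¹ * t)) (summable_conv_norm f g)

theorem conv_apply (f g : Ell1 G) (t : G) : conv f g t = ∑' s, f s * g (s⁻¹ * t) := rfl

theorem summable_mul_apply (f g : Ell1 G) (t : G) : Summable (fun s => f s * g (s⁻¹ * t)) :=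
  Summable.of_norm (by simpa using summable_conv_apply f g t)

theorem norm_conv (f g : Ell1 G) : ‖conv f g‖ ≤ ‖f‖ * ‖g‖ := by
  have h1 : ‖conv f g‖ ≤ ∑' t, ∑' s, ‖f s‖ * ‖g (s⁻¹ * t)‖ := by
    rw [norm_eq]
    exact (summable_conv_norm f g).tsum_le_tsum (norm_conv_le f g) (summable_conv_swap f g).prod
  have h2 : ∑' t, ∑' s, ‖f s‖ * ‖g (s⁻¹ * t)‖ = ‖f‖ * ‖g‖ := by
    rw [(summable_conv f g).tsum_comm, norm_eq f, norm_eq g, ← tsum_mul_right]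
    refine tsum_congr fun s => ?_
    rw [tsum_mul_left]
    congr 1
    exact (Equiv.mulLeft s⁻¹).tsum_eq (fun t => ‖g t‖)
  exact h1.trans h2.le

/-- Convolution as a bounded bilinear map. -/
def convL (G : Type*) [Group G] : Ell1 G →L[ℂ] Ell1 G →L[ℂ] Ell1 G :=
  LinearMap.mkContinuous₂
    (LinearMap.mk₂ ℂ (conv (G := G))
      (fun f f' g => ext fun t => by
        simp only [conv_apply, add_apply, add_mul]
        exact (summable_mul_apply f g t).tsum_add (summable_mul_apply f' g t))
      (fun c f g => ext fun t => by
        simp only [conv_apply, smul_apply, mul_assoc, tsum_mul_left])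
      (fun f g g' => ext fun t => by
        simp only [conv_apply, add_apply, mul_add]
        exact (summable_mul_apply f g t).tsum_add (summable_mul_apply f g' t))
      (fun c f g => ext fun t => by
        simp only [conv_apply, smul_apply, mul_left_comm _ c, tsum_mul_left]))
    1 (fun f g => by simpa using norm_conv f g)

@[simp] theorem convL_apply (f g : Ell1 G) : convL G f g = conv f g := rfl

theorem delta_conv_apply (s : G) (g : Ell1 G) (t : G) : conv (delta s) g t = g (s⁻¹ * t) := by
  rw [conv_apply, tsum_eq_single s]
  · simp [delta_apply]
  · intro u hu
    simp [delta_apply, hu]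

theorem delta_one_conv (g : Ell1 G) : conv (delta 1) g = g :=
  ext fun t => by simp [delta_conv_apply]

theorem conv_delta_one (f : Ell1 G) : conv f (delta 1) = f :=
  ext fun t => by
    rw [conv_apply, tsum_eq_single t]
    · simp [delta_apply]
    · intro u hu
      have : u⁻¹ * t ≠ 1 := fun h => hu (inv_mul_eq_one.1 h)
      simp [delta_apply, this]

theorem conv_assoc (f g h : Ell1 G) : conv (conv f g) h = conv f (conv g h) := by
  have key : ((convL G).flip h).comp ((convL G).flip g) = (convL G).flip (conv g h) := by
    refine clm_ext fun s => ext fun t => ?_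
    change conv (conv (delta s) g) h t = conv (delta s) (conv g h) t
    rw [delta_conv_apply, conv_apply, conv_apply,
      ← (Equiv.mulLeft s).tsum_eq (fun u => conv (delta s) g u * h (u⁻¹ * t))]
    refine tsum_congr fun v => ?_
    simp [delta_conv_apply, mul_assoc]
  exact DFunLike.congr_fun key f

/-- `ℓ¹(G)` with convolution, as a unital Banach algebra. -/
instance : NormedRing (Ell1 G) :=
  { (inferInstance : NormedAddCommGroup (Ell1 G)) with
    mul := conv
    one := delta 1
    mul_assoc := conv_assoc
    one_mul := delta_one_conv
    mul_one := conv_delta_one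
    left_distrib := fun f g h => (convL G f).map_add g h
    right_distrib := fun f g h => by
      change convL G (f + g) h = convL G f h + convL G g h
      simp
    zero_mul := fun f => by
      change convL G 0 f = 0
      simp
    mul_zero := fun f => (convL G f).map_zero
    norm_mul_le := norm_conv }

theorem mul_apply (f g : Ell1 G) (t : G) : (f * g) t = ∑' s, f s * g (s⁻¹ * t) := rfl

instance : NormedAlgebra ℂ (Ell1 G) :=
  { Algebra.ofModule
      (fun c f g => by
        change convL G (c • f) g = c • convL G f g
        simp)
      (fun c f g => (convL G f).map_smul c g) with
    norm_smul_le := norm_smul_le }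

end Algebra

section Inclusion

variable {G : Type*} [Group G]

theorem summable_extend (H : Subgroup G) (f : Ell1 H) :
    Summable (fun t : G => ‖Function.extend (Subtype.val : H → G) f 0 t‖) := by
  refine (Function.Injective.summable_iff (Subtype.val_injective (p := (· ∈ H))) ?_).1 ?_
  · intro t ht
    rw [Function.extend_apply' _ _ _ (fun ⟨a, ha⟩ => ht ⟨a, ha⟩)]
    simp
  · have : (fun t : G => ‖Function.extend (Subtype.val : H → G) f 0 t‖) ∘ Subtype.val
        = fun t : H => ‖f t‖ := by
      funext t
      simp
    rw [this]
    exact f.summable_norm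

/-- Extension by zero `ℓ¹(H) → ℓ¹(G)`, for a subgroup `H` of `G`. -/
def incl (H : Subgroup G) : Ell1 H →L[ℂ] Ell1 G :=
  LinearMap.mkContinuous
    { toFun := fun f => mk (Function.extend (Subtype.val : H → G) f 0) (summable_extend H f)
      map_add' := fun f g => ext fun t => by
        by_cases ht : ∃ a : H, (a : G) = t
        · obtain ⟨a, rfl⟩ := ht
          simp
        · simp [Function.extend_apply' _ _ _ ht]
      map_smul' := fun c f => ext fun t => by
        by_cases ht : ∃ a : H, (a : G) = t
        · obtain ⟨a, rfl⟩ := ht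
          simp
        · simp [Function.extend_apply' _ _ _ ht] }
    1 (fun f => by
      rw [one_mul, norm_eq, norm_eq]
      refine le_of_eq ?_
      rw [← (Subtype.val_injective (p := (· ∈ H))).tsum_eq]
      · refine tsum_congr fun a => ?_
        simp
      · intro t ht
        by_contra h
        refine ht ?_
        have h' : ¬ ∃ a : H, (a : G) = t := fun ⟨a, ha⟩ => h ⟨a, ha⟩
        simp [Function.extend_apply' _ _ _ h'])

theorem incl_apply_mem (H : Subgroup G) (f : Ell1 H) (t : H) : incl H f t = f t :=
  Subtype.val_injective.extend_apply _ _ t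

theorem incl_apply_notMem (H : Subgroup G) (f : Ell1 H) {t : G} (ht : t ∉ H) :
    incl H f t = 0 :=
  Function.extend_apply' _ _ _ (fun ⟨a, ha⟩ => ht (ha ▸ a.2))

end Inclusion

end Ell1

/-! ### Second duals and the first Arens product -/

/-- The second dual `E^{**}` of a normed space. -/
def Bidual (E : Type*) [NormedAddCommGroup E] [NormedSpace ℂ E] : Type _ :=
  StrongDual ℂ (StrongDual ℂ E)

namespace Bidual

section Space

variable {E F : Type*} [NormedAddCommGroup E] [NormedSpace ℂ E]
  [NormedAddCommGroup F] [NormedSpace ℂ F]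

instance : NormedAddCommGroup (Bidual E) :=
  inferInstanceAs (NormedAddCommGroup (StrongDual ℂ (StrongDual ℂ E)))

instance : NormedSpace ℂ (Bidual E) :=
  inferInstanceAs (NormedSpace ℂ (StrongDual ℂ (StrongDual ℂ E)))

instance : CompleteSpace (Bidual E) :=
  inferInstanceAs (CompleteSpace (StrongDual ℂ (StrongDual ℂ E)))

/-- An element of `E^{**}`, as a functional on `E^*`. -/
abbrev toDual (Φ : Bidual E) : StrongDual ℂ (StrongDual ℂ E) := Φ

instance : FunLike (Bidual E) (StrongDual ℂ E) ℂ :=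
  inferInstanceAs (FunLike (StrongDual ℂ (StrongDual ℂ E)) (StrongDual ℂ E) ℂ)

instance : ContinuousLinearMapClass (Bidual E) ℂ (StrongDual ℂ E) ℂ :=
  inferInstanceAs
    (ContinuousLinearMapClass (StrongDual ℂ (StrongDual ℂ E)) ℂ (StrongDual ℂ E) ℂ)

/-- The canonical embedding `E → E^{**}`. -/
def embed (a : E) : Bidual E := NormedSpace.inclusionInDoubleDual ℂ E a

@[simp] theorem embed_apply (a : E) (lam : StrongDual ℂ E) : embed a lam = lam a := rfl

/-- The second adjoint `T^{**} : E^{**} → F^{**}` of `T : E → F`. -/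
def map (T : E →L[ℂ] F) (Φ : Bidual E) : Bidual F :=
  ContinuousLinearMap.comp (toDual Φ)
    ((ContinuousLinearMap.compL ℂ E F ℂ).flip T)

@[simp] theorem map_apply (T : E →L[ℂ] F) (Φ : Bidual E) (lam : StrongDual ℂ F) :
    map T Φ lam = Φ (lam.comp T) := rfl

end Space

section Arens

variable {A : Type*} [NormedRing A] [NormedAlgebra ℂ A]

/-- The functional `λ · a`, where `⟨b, λ · a⟩ = ⟨ab, λ⟩`. -/
def dualAct (lam : StrongDual ℂ A) (a : A) : StrongDual ℂ A :=
  lam.comp (ContinuousLinearMap.mul ℂ A a)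

@[simp] theorem dualAct_apply (lam : StrongDual ℂ A) (a b : A) :
    dualAct lam a b = lam (a * b) := rfl

/-- The functional `Φ · λ`, where `⟨a, Φ · λ⟩ = ⟨Φ, λ · a⟩`; it depends linearly and continuously
on `λ`. -/
def bidualAct (Φ : Bidual A) : StrongDual ℂ A →L[ℂ] StrongDual ℂ A :=
  (ContinuousLinearMap.compL ℂ A (StrongDual ℂ A) ℂ
    (toDual Φ)).comp
    (((ContinuousLinearMap.compL ℂ A (A →L[ℂ] A) (StrongDual ℂ A)).flip
      (ContinuousLinearMap.mul ℂ A)).comp (ContinuousLinearMap.compL ℂ A A ℂ))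

@[simp] theorem bidualAct_apply (Φ : Bidual A) (lam : StrongDual ℂ A) (a : A) :
    bidualAct Φ lam a = Φ (dualAct lam a) := rfl

theorem norm_bidualAct_le (Φ : Bidual A) : ‖bidualAct Φ‖ ≤ ‖Φ‖ := by
  refine ContinuousLinearMap.opNorm_le_bound _ (norm_nonneg _) fun lam => ?_
  refine ContinuousLinearMap.opNorm_le_bound _ (by positivity) fun a => ?_
  rw [bidualAct_apply]
  have h1 : ‖Φ (dualAct lam a)‖ ≤ ‖Φ‖ * ‖dualAct lam a‖ :=
    ContinuousLinearMap.le_opNorm (toDual Φ) _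
  have h2 : ‖dualAct lam a‖ ≤ ‖lam‖ * ‖a‖ :=
    ContinuousLinearMap.opNorm_le_bound _ (by positivity) fun b => by
      rw [dualAct_apply, mul_assoc]
      exact (lam.le_opNorm _).trans (by gcongr; exact norm_mul_le a b)
  calc _ ≤ _ := h1
    _ ≤ ‖Φ‖ * (‖lam‖ * ‖a‖) := by gcongr
    _ = _ := by ring

/-- The first Arens product: `⟨Ψ □ Φ, λ⟩ = ⟨Ψ, Φ · λ⟩`. -/
def arens (Ψ Φ : Bidual A) : Bidual A :=
  ContinuousLinearMap.comp (toDual Ψ) (bidualAct Φ)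

theorem arens_apply (Ψ Φ : Bidual A) (lam : StrongDual ℂ A) :
    arens Ψ Φ lam = Ψ (bidualAct Φ lam) := rfl

theorem ext {Φ Ψ : Bidual A} (h : ∀ lam, Φ lam = Ψ lam) : Φ = Ψ := DFunLike.ext _ _ h

theorem bidualAct_arens (Ψ Φ : Bidual A) (lam : StrongDual ℂ A) :
    bidualAct (arens Ψ Φ) lam = bidualAct Ψ (bidualAct Φ lam) := by
  ext a
  simp only [bidualAct_apply, arens_apply]
  congr 1
  ext b
  simp only [bidualAct_apply, dualAct_apply]
  congr 1
  ext c
  simp [mul_assoc]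

/-- The Banach algebra `A^{**}` with the first Arens product as its multiplication. -/
instance : NormedRing (Bidual A) :=
  { (inferInstance : NormedAddCommGroup (Bidual A)) with
    mul := arens
    one := embed 1
    mul_assoc := fun Θ Ψ Φ => ext fun lam => by
      change Θ (bidualAct Ψ (bidualAct Φ lam)) = Θ (bidualAct (arens Ψ Φ) lam)
      rw [bidualAct_arens]
    one_mul := fun Φ => ext fun lam => by
      change Φ (dualAct lam 1) = Φ lam
      congr 1
      ext b
      simp
    mul_one := fun Φ => ext fun lam => by
      change Φ (bidualAct (embed 1) lam) = Φ lam
      congr 1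
      ext b
      simp
    left_distrib := fun Θ Ψ Φ => ext fun lam =>
      ContinuousLinearMap.map_add (toDual Θ)
        (bidualAct Ψ lam) (bidualAct Φ lam)
    right_distrib := fun _ _ _ => rfl
    zero_mul := fun _ => rfl
    mul_zero := fun Θ => ext fun _ =>
      ContinuousLinearMap.map_zero (toDual Θ)
    norm_mul_le := fun Ψ Φ =>
      (ContinuousLinearMap.opNorm_comp_le (toDual Ψ)
        (bidualAct Φ)).trans (mul_le_mul_of_nonneg_left (norm_bidualAct_le Φ) (norm_nonneg _)) }

theorem mul_apply (Ψ Φ : Bidual A) (lam : StrongDual ℂ A) :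
    (Ψ * Φ) lam = Ψ (bidualAct Φ lam) := rfl

instance : NormedAlgebra ℂ (Bidual A) :=
  { Algebra.ofModule
      (fun _ _ _ => rfl)
      (fun c Ψ Φ => ext fun lam =>
        ContinuousLinearMap.map_smul (toDual Ψ) c
          (bidualAct Φ lam)) with
    norm_smul_le := norm_smul_le }

end Arens

end Bidual

/-! ### Amenability and invariant differences -/

section Invariance

variable {G : Type*} [Group G]

/-- `Φ ∈ ℓ¹(G)^{**}` is left-invariant: `δ_s □ Φ = Φ` for all `s ∈ G`. -/
def IsLeftInvariant (Φ : Bidual (Ell1 G)) : Prop :=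
  ∀ s : G, Bidual.embed (Ell1.delta s) * Φ = Φ

/-- `G` is amenable (as a discrete group): there is a left-invariant mean on `ℓ^∞(G)`, that is,
a left-invariant `M ∈ ℓ¹(G)^{**}` with `‖M‖ = ⟨M, 1⟩ = 1`. -/
def IsAmenable (G : Type*) [Group G] : Prop :=
  ∃ M : Bidual (Ell1 G), ‖M‖ = 1 ∧ M (Ell1.sumCLM G) = 1 ∧ IsLeftInvariant M

/-- `Γ` is an invariant difference on `G`: it is left-invariant and `⟨Γ, 1⟩ = 0`. -/
def IsInvariantDifference (Γ : Bidual (Ell1 G)) : Prop :=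
  IsLeftInvariant Γ ∧ Γ (Ell1.sumCLM G) = 0

/-- The linear span of all `Φ □ Γ`, where `Φ ∈ ℓ¹(G)^{**}` and `Γ` is an invariant difference on
some subnormal subgroup `H` of `G`, regarded as an element of `ℓ¹(G)^{**}`. -/
def Jsn (G : Type*) [Group G] : Submodule ℂ (Bidual (Ell1 G)) :=
  Submodule.span ℂ
    {x | ∃ (Φ : Bidual (Ell1 G)) (H : Subgroup G) (Γ : Bidual (Ell1 H)),
      H.IsSubnormal ∧ IsInvariantDifference Γ ∧ x = Φ * Bidual.map (Ell1.incl H) Γ}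

end Invariance

/-! ### Branch groups -/

/-- `H` is the internal direct product of the subgroups `M j`: distinct factors commute
elementwise, are independent, and together generate `H`. -/
def IsInternalDirectProduct {G ι : Type*} [Group G] (H : Subgroup G) (M : ι → Subgroup G) :
    Prop :=
  (∀ i j, i ≠ j → ∀ x ∈ M i, ∀ y ∈ M j, x * y = y * x) ∧ iSupIndep M ∧ ⨆ i, M i = H

/-- A branch structure on `G`. Sequences start at `0`; the factors of `H i` are indexed by
`Fin (k i)`. -/
structure BranchStructure (G : Type*) [Group G] where
  /-- The chain of normal subgroups. -/
  H : ℕ → Subgroup G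
  /-- The chain of subgroups to which the direct factors are isomorphic. -/
  L : ℕ → Subgroup G
  /-- The numbers of direct factors. -/
  k : ℕ → ℕ
  /-- The direct factors of `H i`. -/
  factor : (i : ℕ) → Fin (k i) → Subgroup G
  antitone_H : Antitone H
  antitone_L : Antitone L
  k_pos : ∀ i, 0 < k i
  iInf_H : ⨅ i, H i = ⊥
  normal_H : ∀ i, (H i).Normal
  finiteIndex_H : ∀ i, (H i).FiniteIndex
  isDirectProduct : ∀ i, IsInternalDirectProduct (H i) (factor i)
  factor_iso : ∀ i j, Nonempty (factor i j ≃* L i)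
  /-- `k (i + 1) / k i` is an integer `m ≥ 2`, and the `j`-th factor of `H i` contains the `j`-th
  block of `m` consecutive factors of `H (i + 1)`. -/
  refines : ∀ i, ∃ m, 2 ≤ m ∧ k (i + 1) = k i * m ∧
    ∀ (j : Fin (k i)) (l : Fin (k (i + 1))), (l : ℕ) / m = j → factor (i + 1) l ≤ factor i j
  /-- Conjugation by elements of `G` permutes the factors of `H i`. -/
  conj_factor : ∀ i (t : G) (j : Fin (k i)), ∃ j',
    (factor i j).map (MulAut.conj t).toMonoidHom = factor i j'
  /-- This permutation action is transitive. -/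
  transitive : ∀ i (j j' : Fin (k i)), ∃ t : G,
    (factor i j).map (MulAut.conj t).toMonoidHom = factor i j'

/-- `G` is a branch group if it has a branch structure. -/
def IsBranchGroup (G : Type*) [Group G] : Prop := Nonempty (BranchStructure G)

/-! ### Nilpotent left ideals -/

section Nilpotent

variable {B : Type*} [Ring B] [Algebra ℂ B]

/-- The subspace `I` is a left ideal of the subalgebra `A` of `B` (given by its underlying
subspace). -/
def IsLeftIdealOf (A I : Submodule ℂ B) : Prop :=
  I ≤ A ∧ ∀ a ∈ A, ∀ x ∈ I, a * x ∈ I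

/-- `I` is nilpotent with index of nilpotence `n`: `n` is the least `n ≥ 1` with `I ^ n = {0}`,
where `I ^ n` is the linear span of the `n`-fold products of elements of `I`. -/
def IsNilpotentOfIndex (I : Submodule ℂ B) (n : ℕ) : Prop :=
  IsLeast {n : ℕ | 1 ≤ n ∧ I ^ n = ⊥} n

/-- `A` contains nilpotent left ideals of arbitrarily large index. They are left ideals of `A` which
are even left ideals of the whole algebra `B`. -/
def HasNilpotentLeftIdealsOfLargeIndex (A : Submodule ℂ B) : Prop :=
  ∀ N : ℕ, ∃ n ≥ N, ∃ I : Submodule ℂ B,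
    IsLeftIdealOf A I ∧ IsLeftIdealOf ⊤ I ∧ IsNilpotentOfIndex I n

end Nilpotent

end

/-! Read `ℓ¹(G)^*` as `ℓ^∞(G)`, on which `Φ ∈ ℓ¹(G)^{**}` acts by `(Φ · λ)(t) = ⟨Φ, s ↦ λ(ts)⟩`. Let
`L_1, …, L_k` be independent, pairwise commuting subgroups permuted by conjugation, with a nonzero
invariant difference `Γ_j` on each, and let `I` be the left ideal of `ℓ¹(G)^{**}` generated by the
`Γ_j`.

Upper bound: filter `ℓ^∞(G)` by the number of the `L_j` under which a function is right invariant.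
Every `Φ` preserves the filtration, because conjugation only permutes the `L_j`; acting by `Γ_j`
raises the level by one, because it adds invariance under `L_j` and kills what is already invariant.
Beyond level `k` nothing is left, so `I ^ (k + 1) = 0`
(`IsPermutedFamily.leftIdealSpan_pow_eq_bot`).

Lower bound: choose `F_j` with `⟨Γ_j, F_j⟩ = 1` and apply `(∑ Γ_j) ^ k` to the product of the `F_j`
on the direct product of the `L_j`. Each `Γ_i` removes the factor `F_i`, and the `k!` orders of
removal add up without cancellation (`IsPermutedFamily.sum_pow_ne_zero`).

Nilpotent left ideals lie in the radical. If the radical were nil, Baire's theorem would bound the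
order of nilpotence of its elements, so arbitrarily large families force a non-nilpotent `x`
(`exists_mem_jacobson_not_isNilpotent`); then `x * x ≠ 0` as well.

In an infinite amenable branch group the factors of `H i` form such families: they are infinite,
inherit invariant means, and are subnormal, which puts `I` inside `Jsn G`. Nonzero differences come
from a thick set with thick complement. The finitely generated example is a group of Hall type whose
centre contains infinitely many independent infinite cyclic subgroups. -/

noncomputable section

/-! ### Bounded operators on `ℓ¹(G)` prescribed on point masses -/

namespace Ell1

section Lift

variable {G E : Type*} [NormedAddCommGroup E] [NormedSpace ℂ E]

theorem norm_delta (t : G) : ‖delta t‖ = 1 := by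
  rw [norm_eq, tsum_eq_single t]
  · simp [delta_apply]
  · intro u hu
    simp [delta_apply, hu]

theorem summable_smul_norm (f : Ell1 G) {v : G → E} {C : ℝ} (hv : ∀ g, ‖v g‖ ≤ C) :
    Summable (fun g => ‖f g • v g‖) := by
  refine Summable.of_nonneg_of_le (fun _ => norm_nonneg _) (fun g => ?_)
    (f.summable_norm.mul_right C)
  rw [norm_smul]
  exact mul_le_mul_of_nonneg_left (hv g) (norm_nonneg _)

theorem norm_tsum_smul_le (f : Ell1 G) {v : G → E} {C : ℝ} (hv : ∀ g, ‖v g‖ ≤ C) :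
    ‖∑' g, f g • v g‖ ≤ C * ‖f‖ := by
  have h : ∀ g, ‖f g • v g‖ ≤ C * ‖f g‖ := fun g => by
    rw [norm_smul, mul_comm]
    exact mul_le_mul_of_nonneg_right (hv g) (norm_nonneg _)
  have hs := summable_smul_norm f hv
  have hC := f.summable_norm.mul_left C
  calc ‖∑' g, f g • v g‖ ≤ ∑' g, ‖f g • v g‖ := norm_tsum_le_tsum_norm hs
    _ ≤ ∑' g, C * ‖f g‖ := hs.tsum_le_tsum h hC
    _ = C * ‖f‖ := by rw [norm_eq f, ← tsum_mul_left]

variable [CompleteSpace E]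

/-- The bounded linear map on `ℓ¹(G)` that sends `δ_g` to `v g`, for a bounded family `v`. -/
def lift (v : G → E) (C : ℝ) (hv : ∀ g, ‖v g‖ ≤ C) : Ell1 G →L[ℂ] E :=
  LinearMap.mkContinuous
    { toFun := fun f => ∑' g, f g • v g
      map_add' := fun f f' => by
        simp only [add_apply, add_smul]
        exact (summable_smul_norm f hv).of_norm.tsum_add (summable_smul_norm f' hv).of_norm
      map_smul' := fun c f => by
        simp only [smul_apply, mul_smul, RingHom.id_apply]
        exact (summable_smul_norm f hv).of_norm.tsum_const_smul c }
    C (fun f => norm_tsum_smul_le f hv)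

@[simp] theorem lift_delta (v : G → E) (C : ℝ) (hv : ∀ g, ‖v g‖ ≤ C) (t : G) :
    lift v C hv (delta t) = v t := by
  change ∑' g, (delta t) g • v g = v t
  rw [tsum_eq_single t]
  · simp [delta_apply]
  · intro u hu
    simp [delta_apply, hu]

/-- The map `ℓ¹(G) → ℓ¹(G')` induced by a map `G → G'`. -/
def push {G' : Type*} (r : G → G') : Ell1 G →L[ℂ] Ell1 G' :=
  lift (fun g => delta (r g)) 1 (fun g => (norm_delta (r g)).le)

@[simp] theorem push_delta {G' : Type*} (r : G → G') (t : G) :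
    push r (delta t) = delta (r t) := lift_delta _ _ _ _

open Classical in
/-- The projection of `ℓ¹(G)` onto the functions supported in `s`. -/
def restrict (s : Set G) : Ell1 G →L[ℂ] Ell1 G :=
  lift (fun g => if g ∈ s then delta g else 0) 1 (fun g => by
    split_ifs
    · exact (norm_delta g).le
    · simp)

open Classical in
@[simp] theorem restrict_delta (s : Set G) (t : G) :
    restrict s (delta t) = if t ∈ s then delta t else 0 := lift_delta _ _ _ _

@[simp] theorem sumCLM_delta (t : G) : sumCLM G (delta t) = 1 := by
  rw [sumCLM_apply, tsum_eq_single t]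
  · simp [delta_apply]
  · intro u hu
    simp [delta_apply, hu]

end Lift

section Group

variable {G : Type*} [Group G]

@[simp] theorem delta_mul_delta (s t : G) : delta s * delta t = delta (s * t) := by
  refine ext fun u => ?_
  change conv (delta s) (delta t) u = _
  classical
  rw [delta_conv_apply, delta_apply, delta_apply]
  exact if_congr inv_mul_eq_iff_eq_mul rfl rfl

@[simp] theorem incl_delta (H : Subgroup G) (t : H) : incl H (delta t) = delta (t : G) := by
  refine ext fun u => ?_
  by_cases hu : u ∈ H
  · lift u to H using hu
    rw [incl_apply_mem]
    by_cases h : u = t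
    · simp [delta_apply, h]
    · simp [delta_apply, h, mt Subtype.ext h]
  · rw [incl_apply_notMem _ _ hu, delta_apply, if_neg]
    rintro rfl
    exact hu t.2

end Group

end Ell1

/-! ### Weak-star limits and the action of the second dual on the dual -/

namespace Bidual

section Space

variable {E : Type*} [NormedAddCommGroup E] [NormedSpace ℂ E]

@[simp] theorem add_apply (Φ Ψ : Bidual E) (lam : StrongDual ℂ E) :
    (Φ + Ψ) lam = Φ lam + Ψ lam := rfl

@[simp] theorem sub_apply (Φ Ψ : Bidual E) (lam : StrongDual ℂ E) :
    (Φ - Ψ) lam = Φ lam - Ψ lam := rfl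

@[simp] theorem smul_apply (c : ℂ) (Φ : Bidual E) (lam : StrongDual ℂ E) :
    (c • Φ) lam = c * Φ lam := rfl

@[simp] theorem zero_apply (lam : StrongDual ℂ E) : (0 : Bidual E) lam = 0 := rfl

@[simp] theorem sum_apply {ι : Type*} (s : Finset ι) (Φ : ι → Bidual E)
    (lam : StrongDual ℂ E) : (∑ i ∈ s, Φ i) lam = ∑ i ∈ s, Φ i lam := by
  classical
  induction s using Finset.induction_on with
  | empty => simp
  | insert i s hi ih => simp [Finset.sum_insert hi, ih]

/-- Bounded families have weak-star limits along ultrafilters. -/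
theorem exists_limit {ι : Type*} (U : Ultrafilter ι) (a : ι → E) {C : ℝ} (ha : ∀ i, ‖a i‖ ≤ C) :
    ∃ Φ : Bidual E, ∀ lam : StrongDual ℂ E,
      Filter.Tendsto (fun i => lam (a i)) U (nhds (Φ lam)) := by
  have hc := WeakDual.isCompact_closedBall (𝕜 := ℂ) (E := StrongDual ℂ E) 0 C
  let f : ι → WeakDual ℂ (StrongDual ℂ E) :=
    fun i => StrongDual.toWeakDual (NormedSpace.inclusionInDoubleDual ℂ E (a i))
  obtain ⟨Φ, -, hΦ⟩ := hc.ultrafilter_le_nhds (U.map f) (by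
    rw [Filter.le_principal_iff]
    refine Filter.mem_map.2 (Filter.univ_mem' fun i => ?_)
    have h : ‖NormedSpace.inclusionInDoubleDual ℂ E (a i)‖ ≤ C :=
      (NormedSpace.double_dual_bound ℂ E (a i)).trans (ha i)
    change NormedSpace.inclusionInDoubleDual ℂ E (a i) ∈
      Metric.closedBall (0 : StrongDual ℂ (StrongDual ℂ E)) C
    exact (dist_zero_right (NormedSpace.inclusionInDoubleDual ℂ E (a i))).trans_le h)
  refine ⟨WeakDual.toStrongDual Φ, fun lam => ?_⟩
  have h : Filter.Tendsto f U (nhds Φ) := hΦ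
  exact ((WeakDual.eval_continuous lam).tendsto Φ).comp h

end Space

section Arens

variable {A : Type*} [NormedRing A] [NormedAlgebra ℂ A]

@[simp] theorem bidualAct_mul (Ψ Φ : Bidual A) (lam : StrongDual ℂ A) :
    bidualAct (Ψ * Φ) lam = bidualAct Ψ (bidualAct Φ lam) := bidualAct_arens Ψ Φ lam

@[simp] theorem bidualAct_add (Ψ Φ : Bidual A) (lam : StrongDual ℂ A) :
    bidualAct (Ψ + Φ) lam = bidualAct Ψ lam + bidualAct Φ lam := rfl

@[simp] theorem bidualAct_zero (lam : StrongDual ℂ A) :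
    bidualAct (0 : Bidual A) lam = 0 := rfl

theorem bidualAct_sum {ι : Type*} (s : Finset ι) (Φ : ι → Bidual A) (lam : StrongDual ℂ A) :
    bidualAct (∑ i ∈ s, Φ i) lam = ∑ i ∈ s, bidualAct (Φ i) lam := by
  ext a
  simp

theorem bidualAct_apply_one (Φ : Bidual A) (lam : StrongDual ℂ A) :
    bidualAct Φ lam 1 = Φ lam := by
  rw [bidualAct_apply]
  congr 1
  ext b
  simp

@[simp] theorem bidualAct_one (lam : StrongDual ℂ A) :
    bidualAct (1 : Bidual A) lam = lam := by
  ext a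
  change dualAct lam a 1 = lam a
  simp

theorem dualAct_dualAct (lam : StrongDual ℂ A) (a b : A) :
    dualAct (dualAct lam a) b = dualAct lam (a * b) := by
  ext c
  simp [mul_assoc]

end Arens

end Bidual

section Invariance

open Bidual

variable {G : Type*} [Group G]

theorem isLeftInvariant_iff {Φ : Bidual (Ell1 G)} :
    IsLeftInvariant Φ ↔
      ∀ (s : G) (lam : StrongDual ℂ (Ell1 G)), Φ (dualAct lam (Ell1.delta s)) = Φ lam :=
  ⟨fun h s lam => DFunLike.congr_fun (h s) lam, fun h s => Bidual.ext (h s)⟩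

theorem IsLeftInvariant.mul {M : Bidual (Ell1 G)} (hM : IsLeftInvariant M)
    (Φ : Bidual (Ell1 G)) : IsLeftInvariant (M * Φ) := fun s => by
  rw [← mul_assoc, hM s]

/-- `⟨M □ Φ, 1⟩ = ⟨M, 1⟩ ⟨Φ, 1⟩`. -/
theorem Bidual.bidualAct_sumCLM (Φ : Bidual (Ell1 G)) :
    bidualAct Φ (Ell1.sumCLM G) = Φ (Ell1.sumCLM G) • Ell1.sumCLM G := by
  refine Ell1.clm_ext fun t => ?_
  have : dualAct (Ell1.sumCLM G) (Ell1.delta t) = Ell1.sumCLM G :=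
    Ell1.clm_ext fun s => by
      rw [dualAct_apply, Ell1.delta_mul_delta, Ell1.sumCLM_delta, Ell1.sumCLM_delta]
  rw [bidualAct_apply, this, _root_.smul_apply, Ell1.sumCLM_delta, smul_eq_mul,
    mul_one]

end Invariance

open Bidual Ell1

/-! ### How a functional on a subgroup changes right invariance -/

section Subgroup

variable {G : Type*} [Group G]

theorem bidualAct_map_incl (H : Subgroup G) (Γ : Bidual (Ell1 H)) (lam : StrongDual ℂ (Ell1 G))
    (t : G) : bidualAct (Bidual.map (incl H) Γ) lam (delta t) =
      Γ ((dualAct lam (delta t)).comp (incl H)) := rfl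

/-- The value at `t * h` is `Γ` applied to `u ↦ lam (t * h * u)`, a translate by `h ∈ H` of the
function giving the value at `t`; left invariance of `Γ` absorbs it. -/
theorem IsLeftInvariant.bidualAct_mul_right {H : Subgroup G} {Γ : Bidual (Ell1 H)}
    (hΓ : IsLeftInvariant Γ) (lam : StrongDual ℂ (Ell1 G)) (t : G) {h : G} (hh : h ∈ H) :
    bidualAct (Bidual.map (incl H) Γ) lam (delta (t * h)) =
      bidualAct (Bidual.map (incl H) Γ) lam (delta t) := by
  rw [bidualAct_map_incl, bidualAct_map_incl,
    ← isLeftInvariant_iff.1 hΓ ⟨h, hh⟩ ((dualAct lam (delta t)).comp (incl H))]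
  congr 1
  refine clm_ext fun u => ?_
  simp [mul_assoc]

/-- Since `g` commutes with each `u ∈ H`, it moves past `u` in `t * g * u` to the right end, where
`lam` does not see it. -/
theorem bidualAct_mul_right_of_commute {H : Subgroup G} (Γ : Bidual (Ell1 H))
    {lam : StrongDual ℂ (Ell1 G)} {g : G} (hg : ∀ h ∈ H, g * h = h * g)
    (hlam : ∀ t, lam (delta (t * g)) = lam (delta t)) (t : G) :
    bidualAct (Bidual.map (incl H) Γ) lam (delta (t * g)) =
      bidualAct (Bidual.map (incl H) Γ) lam (delta t) := by
  rw [bidualAct_map_incl, bidualAct_map_incl]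
  congr 1
  refine clm_ext fun u => ?_
  simp [mul_assoc, hg u u.2]
  simp [← mul_assoc, hlam]

/-- On each coset `t H` the functional is constant, and `Γ` annihilates constants. -/
theorem IsInvariantDifference.bidualAct_eq_zero {H : Subgroup G} {Γ : Bidual (Ell1 H)}
    (hΓ : IsInvariantDifference Γ) {lam : StrongDual ℂ (Ell1 G)}
    (hlam : ∀ h ∈ H, ∀ t, lam (delta (t * h)) = lam (delta t)) :
    bidualAct (Bidual.map (incl H) Γ) lam = 0 := by
  refine clm_ext fun t => ?_
  have : (dualAct lam (delta t)).comp (incl H) = lam (delta t) • sumCLM H :=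
    clm_ext fun u => by simp [hlam u u.2, -sumCLM_apply]
  rw [bidualAct_map_incl, this, map_smul, hΓ.2, smul_zero]
  rfl

/-- An element of `ℓ¹(G)^{**}` is the sum of its restrictions to the fibres of a map to a
finite set. -/
theorem Bidual.sum_map_restrict {κ : Type*} [Fintype κ] (P : G → κ) (Φ : Bidual (Ell1 G)) :
    ∑ c, Bidual.map (restrict (P ⁻¹' {c})) Φ = Φ := by
  classical
  refine Bidual.ext fun lam => ?_
  rw [Bidual.sum_apply]
  simp only [Bidual.map_apply]
  rw [← map_sum]
  congr 1
  refine clm_ext fun t => ?_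
  simp only [FunLike.coe_sum, Finset.sum_apply, ContinuousLinearMap.comp_apply,
    restrict_delta, Set.mem_preimage, Set.mem_singleton_iff]
  rw [Finset.sum_eq_single (P t)]
  · simp
  · intro c _ hc
    simp [hc.symm]
  · simp

end Subgroup

/-! ### Left ideals generated by a family -/

section LeftIdeal

variable {B ι : Type*} [Ring B] [Algebra ℂ B]

/-- The left ideal generated by a family of elements of an algebra. -/
def leftIdealSpan (y : ι → B) : Submodule ℂ B :=
  Submodule.span ℂ {x | ∃ (a : B) (j : ι), x = a * y j}

theorem mul_mem_leftIdealSpan {y : ι → B} (a : B) {x : B} (hx : x ∈ leftIdealSpan y) :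
    a * x ∈ leftIdealSpan y := by
  induction hx using Submodule.span_induction with
  | mem x hx =>
    obtain ⟨b, j, rfl⟩ := hx
    exact Submodule.subset_span ⟨a * b, j, (mul_assoc _ _ _).symm⟩
  | zero => simp
  | add x y _ _ hx hy => rw [mul_add]; exact add_mem hx hy
  | smul c x _ hx => rw [mul_smul_comm]; exact Submodule.smul_mem _ c hx

theorem sum_mem_leftIdealSpan [Fintype ι] (y : ι → B) : ∑ j, y j ∈ leftIdealSpan y :=
  sum_mem fun j _ => Submodule.subset_span ⟨1, j, (one_mul _).symm⟩

end LeftIdeal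

/-! ### The invariance filtration and the upper bound for the index -/

section Family

variable {G ι : Type*} [Group G]

/-- Independent subgroups whose elements commute pairwise and which are permuted by
conjugation. -/
structure IsPermutedFamily (L : ι → Subgroup G) : Prop where
  commute : ∀ i j, i ≠ j → ∀ x ∈ L i, ∀ y ∈ L j, x * y = y * x
  iSupIndep : iSupIndep L
  injective : Function.Injective L
  conj : ∀ (g : G) (j : ι), ∃ j', (L j).map (MulAut.conj g).toMonoidHom = L j'

/-- The functionals in `ℓ^∞(G)` that are invariant under right translation by elements of `L j`,
for `j ∈ S`. -/
def rightInvariant (L : ι → Subgroup G) (S : Finset ι) :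
    Submodule ℂ (StrongDual ℂ (Ell1 G)) where
  carrier := {lam | ∀ j ∈ S, ∀ h ∈ L j, ∀ t, lam (delta (t * h)) = lam (delta t)}
  add_mem' := fun ha hb j hj h hh t => by
    simp only [_root_.add_apply, ha j hj h hh t, hb j hj h hh t]
  zero_mem' := fun _ _ _ _ _ => rfl
  smul_mem' := fun c a ha j hj h hh t => by
    simp only [_root_.smul_apply, ha j hj h hh t]

/-- The span of the functionals that are right invariant under at least `m` of the subgroups
`L j`. -/
def invarianceLevel (L : ι → Subgroup G) (m : ℕ) : Submodule ℂ (StrongDual ℂ (Ell1 G)) :=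
  ⨆ (S : Finset ι) (_ : m ≤ S.card), rightInvariant L S

theorem rightInvariant_le_invarianceLevel (L : ι → Subgroup G) {S : Finset ι} {m : ℕ}
    (h : m ≤ S.card) : rightInvariant L S ≤ invarianceLevel L m :=
  le_iSup₂_of_le S h le_rfl

theorem invarianceLevel_zero (L : ι → Subgroup G) : invarianceLevel L 0 = ⊤ :=
  top_unique fun _ _ => rightInvariant_le_invarianceLevel L (S := ∅) (Nat.zero_le _)
    fun j hj => absurd hj (Finset.notMem_empty j)

theorem invarianceLevel_eq_bot [Fintype ι] (L : ι → Subgroup G) :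
    invarianceLevel L (Fintype.card ι + 1) = ⊥ :=
  bot_unique (iSup₂_le fun S hS => absurd (S.card_le_univ) (by omega))

/-- To map one level into another, it is enough to do so on generators. -/
theorem bidualAct_mem_invarianceLevel {L : ι → Subgroup G} {Φ : Bidual (Ell1 G)} {m n : ℕ}
    (h : ∀ S : Finset ι, m ≤ S.card → ∀ lam ∈ rightInvariant L S,
      bidualAct Φ lam ∈ invarianceLevel L n) {lam : StrongDual ℂ (Ell1 G)}
    (hlam : lam ∈ invarianceLevel L m) : bidualAct Φ lam ∈ invarianceLevel L n := by
  have : invarianceLevel L m ≤ (invarianceLevel L n).comap (bidualAct Φ).toLinearMap :=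
    iSup₂_le fun S hS lam hl => h S hS lam hl
  exact this hlam

/-- For a generator invariant under the `L i`, `i ∈ S`, there are two cases. If `j ∈ S`, the result
is zero; otherwise invariance under `L j` is gained, and the old invariances survive because `L j`
commutes with the other members. -/
theorem bidualAct_map_incl_mem_invarianceLevel {L : ι → Subgroup G} (hL : IsPermutedFamily L)
    {j : ι} {Γ : Bidual (Ell1 (L j))} (hΓ : IsInvariantDifference Γ) {m : ℕ}
    {lam : StrongDual ℂ (Ell1 G)} (hlam : lam ∈ invarianceLevel L m) :
    bidualAct (Bidual.map (incl (L j)) Γ) lam ∈ invarianceLevel L (m + 1) := by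
  classical
  refine bidualAct_mem_invarianceLevel (fun S hS lam hl => ?_) hlam
  by_cases hj : j ∈ S
  · rw [hΓ.bidualAct_eq_zero (hl j hj)]
    exact zero_mem _
  · refine rightInvariant_le_invarianceLevel L (S := insert j S)
      (by rw [Finset.card_insert_of_notMem hj]; omega) fun i hi h hh t => ?_
    rcases Finset.mem_insert.1 hi with rfl | hi
    · exact hΓ.1.bidualAct_mul_right lam t hh
    · exact bidualAct_mul_right_of_commute Γ
        (hL.commute i j (fun hij => hj (hij ▸ hi)) h hh) (hl i hi h hh) t

theorem IsPermutedFamily.exists_perm [Finite ι] {L : ι → Subgroup G} (hL : IsPermutedFamily L)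
    (g : G) : ∃ p : Equiv.Perm ι, ∀ j, (L j).map (MulAut.conj g).toMonoidHom = L (p j) := by
  choose p hp using hL.conj g
  have hinj : Function.Injective p := fun i j hij => hL.injective <|
    Subgroup.map_injective (MulAut.conj g).injective ((hp i).trans ((hp j).trans (by rw [hij])).symm)
  exact ⟨Equiv.ofBijective p (Finite.injective_iff_bijective.1 hinj), hp⟩

/-- Moving `h` past `s` in `t * h * s` replaces it by its conjugate `s⁻¹ * h * s`. Only finitely
many permutations of the family arise from conjugation, so `Φ` splits into finitely many pieces, on
each of which `s` induces a fixed `p`; such a piece carries invariance under `S` to invariance under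
`p(S)`, a set of the same size. -/
theorem IsPermutedFamily.bidualAct_mem_invarianceLevel [Fintype ι] {L : ι → Subgroup G}
    (hL : IsPermutedFamily L) (Φ : Bidual (Ell1 G)) {m : ℕ}
    {lam : StrongDual ℂ (Ell1 G)} (hlam : lam ∈ invarianceLevel L m) :
    bidualAct Φ lam ∈ invarianceLevel L m := by
  classical
  refine _root_.bidualAct_mem_invarianceLevel (fun S hS lam hl => ?_) hlam
  choose P hP using hL.exists_perm
  rw [← Bidual.sum_map_restrict P Φ, bidualAct_sum]
  refine sum_mem fun p _ => rightInvariant_le_invarianceLevel L (S := S.map p.toEmbedding)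
    (by rwa [Finset.card_map]) fun i hi h hh t => ?_
  obtain ⟨j, hj, rfl⟩ := Finset.mem_map.1 hi
  simp only [bidualAct_apply, Bidual.map_apply]
  congr 1
  refine clm_ext fun s => ?_
  simp only [ContinuousLinearMap.comp_apply, restrict_delta, Set.mem_preimage,
    Set.mem_singleton_iff]
  split_ifs with hs
  · subst hs
    have hh' : h ∈ (L j).map (MulAut.conj s).toMonoidHom := by rw [hP]; exact hh
    obtain ⟨u, hu, rfl⟩ := hh'
    have : t * (MulAut.conj s).toMonoidHom u * s = t * s * u := by simp [mul_assoc]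
    rw [dualAct_apply, dualAct_apply, delta_mul_delta, delta_mul_delta, this, hl j hj u hu]
  · simp

theorem IsPermutedFamily.bidualAct_mem_of_mem_leftIdealSpan [Fintype ι] {L : ι → Subgroup G}
    (hL : IsPermutedFamily L) {Γ : ∀ j, Bidual (Ell1 (L j))}
    (hΓ : ∀ j, IsInvariantDifference (Γ j)) {x : Bidual (Ell1 G)}
    (hx : x ∈ leftIdealSpan (fun j => Bidual.map (incl (L j)) (Γ j)))
    {m : ℕ} {lam : StrongDual ℂ (Ell1 G)} (hlam : lam ∈ invarianceLevel L m) :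
    bidualAct x lam ∈ invarianceLevel L (m + 1) := by
  induction hx using Submodule.span_induction with
  | mem x hx =>
    obtain ⟨Φ, j, rfl⟩ := hx
    rw [bidualAct_mul]
    exact hL.bidualAct_mem_invarianceLevel Φ (bidualAct_map_incl_mem_invarianceLevel hL (hΓ j) hlam)
  | zero => simp
  | add x y _ _ hx hy => rw [bidualAct_add]; exact add_mem hx hy
  | smul c x _ hx => exact Submodule.smul_mem _ c hx

/-- The left ideal generated by invariant differences on the members of a permuted family of `k`
subgroups satisfies `I ^ (k + 1) = 0`. -/
theorem IsPermutedFamily.leftIdealSpan_pow_eq_bot [Fintype ι] {L : ι → Subgroup G}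
    (hL : IsPermutedFamily L) {Γ : ∀ j, Bidual (Ell1 (L j))}
    (hΓ : ∀ j, IsInvariantDifference (Γ j)) :
    leftIdealSpan (fun j => Bidual.map (incl (L j)) (Γ j)) ^ (Fintype.card ι + 1) = ⊥ := by
  have key : ∀ (n : ℕ), ∀ x ∈ leftIdealSpan (fun j => Bidual.map (incl (L j)) (Γ j)) ^ n, ∀ lam,
      bidualAct x lam ∈ invarianceLevel L n := by
    intro n
    induction n with
    | zero =>
      intro x _ lam
      rw [invarianceLevel_zero]
      trivial
    | succ n ih =>
      intro x hx lam
      -- The left factor of a product acts last, so the new element of the ideal is split off on the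
      -- left.
      rw [pow_succ'] at hx
      induction hx using Submodule.mul_induction_on' with
      | mem_mul_mem a ha b hb =>
        rw [bidualAct_mul]
        exact hL.bidualAct_mem_of_mem_leftIdealSpan hΓ ha (ih b hb lam)
      | add a _ b _ ha hb => rw [bidualAct_add]; exact add_mem ha hb
  refine bot_unique fun x hx => ?_
  refine (Submodule.mem_bot ℂ).2 (Bidual.ext fun lam => ?_)
  have h := key _ x hx lam
  rw [invarianceLevel_eq_bot, Submodule.mem_bot] at h
  -- The pairing of `x` with `lam` is the value of `x · lam` at the unit.
  rw [← bidualAct_apply_one, h]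
  rfl

end Family

/-! ### Product functionals and the lower bound for the index -/

section Nonvanishing

variable {G ι : Type*} [Group G]

theorem IsPermutedFamily.pairwise_commute {L : ι → Subgroup G} (hL : IsPermutedFamily L) :
    Pairwise fun i j : ι => ∀ x y : G, x ∈ L i → y ∈ L j → Commute x y :=
  fun i j hij x y hx hy => hL.commute i j hij x hx y hy

/-- The functional `∏_{j ∈ S} F j` on the direct product of the subgroups `L j`, extended by zero
to `G`. -/
def prodFunctional {L : ι → Subgroup G} (φ : (∀ j, L j) →* G)
    (F : ∀ j, StrongDual ℂ (Ell1 (L j))) (S : Finset ι) : StrongDual ℂ (Ell1 G) :=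
  lift (Function.extend φ (fun u => ∏ j ∈ S, F j (delta (u j))) 0) (∏ j ∈ S, ‖F j‖) fun g => by
    by_cases hg : ∃ u, φ u = g
    · classical
      rw [Function.extend_def, dif_pos hg, norm_prod]
      refine Finset.prod_le_prod (fun _ _ => norm_nonneg _) fun j _ => ?_
      exact ((F j).le_opNorm _).trans (by rw [norm_delta, mul_one])
    · rw [Function.extend_apply' _ _ _ hg]
      simpa using Finset.prod_nonneg fun j _ => norm_nonneg (F j)

theorem prodFunctional_apply {L : ι → Subgroup G} {φ : (∀ j, L j) →* G}
    (hφ : Function.Injective φ) (F : ∀ j, StrongDual ℂ (Ell1 (L j))) (S : Finset ι)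
    (u : ∀ j, L j) : prodFunctional φ F S (delta (φ u)) = ∏ j ∈ S, F j (delta (u j)) := by
  rw [prodFunctional, lift_delta, hφ.extend_apply]

theorem prodFunctional_apply_of_notMem {L : ι → Subgroup G} {φ : (∀ j, L j) →* G}
    (F : ∀ j, StrongDual ℂ (Ell1 (L j))) (S : Finset ι) {t : G} (ht : t ∉ φ.range) :
    prodFunctional φ F S (delta t) = 0 := by
  rw [prodFunctional, lift_delta, Function.extend_apply' _ _ _ fun ⟨u, hu⟩ => ht ⟨u, hu⟩]
  rfl

/-- Along a coset of `L i` inside the direct product only the factor `F i` varies, and `Γ i`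
integrates its translates to `1`. Off the direct product everything vanishes, as right translation
by `L i` does not lead back into it. If `i ∉ S`, the function is already right invariant under `L
i`, so it is killed. -/
theorem bidualAct_prodFunctional [DecidableEq ι] {L : ι → Subgroup G} {φ : (∀ j, L j) →* G}
    (hφ : Function.Injective φ) (hφ' : ∀ j (h : L j), φ (Pi.mulSingle j h) = h)
    {Γ : ∀ j, Bidual (Ell1 (L j))} (hΓ : ∀ j, IsInvariantDifference (Γ j))
    {F : ∀ j, StrongDual ℂ (Ell1 (L j))} (hF : ∀ j, Γ j (F j) = 1) (i : ι) (S : Finset ι) :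
    bidualAct (Bidual.map (incl (L i)) (Γ i)) (prodFunctional φ F S) =
      if i ∈ S then prodFunctional φ F (S.erase i) else 0 := by
  split_ifs with hi
  · refine clm_ext fun t => ?_
    rw [bidualAct_map_incl]
    by_cases ht : t ∈ φ.range
    · obtain ⟨u, rfl⟩ := ht
      have : (dualAct (prodFunctional φ F S) (delta (φ u))).comp (incl (L i)) =
          (∏ j ∈ S.erase i, F j (delta (u j))) • dualAct (F i) (delta (u i)) := by
        refine clm_ext fun h => ?_
        rw [ContinuousLinearMap.comp_apply, incl_delta, dualAct_apply, delta_mul_delta, ← hφ' i h,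
          ← map_mul, prodFunctional_apply hφ, ← Finset.prod_erase_mul _ _ hi, _root_.smul_apply,
          dualAct_apply, delta_mul_delta, smul_eq_mul]
        congr 1
        · refine Finset.prod_congr rfl fun j hj => ?_
          simp [Pi.mulSingle_eq_of_ne (Finset.ne_of_mem_erase hj)]
        · simp
      rw [this, map_smul, isLeftInvariant_iff.1 (hΓ i).1, hF, prodFunctional_apply hφ, smul_eq_mul,
        mul_one]
    · have : (dualAct (prodFunctional φ F S) (delta t)).comp (incl (L i)) = 0 := by
        refine clm_ext fun h => ?_
        rw [ContinuousLinearMap.comp_apply, incl_delta, dualAct_apply, delta_mul_delta,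
          prodFunctional_apply_of_notMem]
        · rfl
        · rw [← hφ' i h]
          rwa [Subgroup.mul_mem_cancel_right _ (MonoidHom.mem_range.2 ⟨_, rfl⟩)]
      rw [this, map_zero, prodFunctional_apply_of_notMem _ _ ht]
  · refine (hΓ i).bidualAct_eq_zero fun h hh t => ?_
    lift h to L i using hh
    by_cases ht : t ∈ φ.range
    · obtain ⟨u, rfl⟩ := ht
      rw [← hφ' i h, ← map_mul, prodFunctional_apply hφ, prodFunctional_apply hφ]
      refine Finset.prod_congr rfl fun j hj => ?_
      have : j ≠ i := fun hji => hi (hji ▸ hj)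
      simp [Pi.mulSingle_eq_of_ne this]
    · rw [prodFunctional_apply_of_notMem _ _ ht, prodFunctional_apply_of_notMem]
      rw [← hφ' i h]
      rwa [Subgroup.mul_mem_cancel_right _ (MonoidHom.mem_range.2 ⟨_, rfl⟩)]

/-- The `k`-th power of the sum of nonzero invariant differences on `k` independent commuting
subgroups is nonzero. -/
theorem IsPermutedFamily.sum_pow_ne_zero [Fintype ι] {L : ι → Subgroup G} (hL : IsPermutedFamily L)
    {Γ : ∀ j, Bidual (Ell1 (L j))} (hΓ : ∀ j, IsInvariantDifference (Γ j))
    (hΓ0 : ∀ j, Γ j ≠ 0) :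
    (∑ j, Bidual.map (incl (L j)) (Γ j)) ^ Fintype.card ι ≠ 0 := by
  classical
  have hF : ∀ j, ∃ F, Γ j F = 1 := fun j => by
    obtain ⟨F, hF⟩ : ∃ F, Γ j F ≠ 0 := by
      by_contra! h
      exact hΓ0 j (Bidual.ext h)
    exact ⟨(Γ j F)⁻¹ • F, by rw [map_smul, smul_eq_mul, inv_mul_cancel₀ hF]⟩
  choose F hF using hF
  let φ := Subgroup.noncommPiCoprod hL.pairwise_commute
  have hφ : Function.Injective φ := Subgroup.injective_noncommPiCoprod_of_iSupIndep hL.iSupIndep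
  have hφ' : ∀ j (h : L j), φ (Pi.mulSingle j h) = h :=
    fun j h => Subgroup.noncommPiCoprod_mulSingle j h
  have key : ∀ (n : ℕ) (S : Finset ι), S.card = n →
      bidualAct ((∑ j, Bidual.map (incl (L j)) (Γ j)) ^ n) (prodFunctional φ F S) =
        (n.factorial : ℂ) • prodFunctional φ F ∅ := by
    intro n
    induction n with
    | zero =>
      intro S hS
      rw [Finset.card_eq_zero.1 hS, pow_zero, bidualAct_one]
      simp
    | succ n ih =>
      intro S hS
      rw [pow_succ, bidualAct_mul, bidualAct_sum]
      simp only [bidualAct_prodFunctional hφ hφ' hΓ hF]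
      rw [Finset.sum_ite_mem, Finset.univ_inter, map_sum, Finset.sum_congr rfl fun i hi =>
        ih (S.erase i) (by rw [Finset.card_erase_of_mem hi, hS]; rfl), Finset.sum_const, hS,
        Nat.factorial_succ]
      push_cast
      rw [mul_smul, ← Nat.cast_smul_eq_nsmul ℂ]
      push_cast
      rfl
  intro h0
  have h := key _ Finset.univ Finset.card_univ
  rw [h0, bidualAct_zero] at h
  -- The empty product is the indicator of the range of `φ`, so its value at the identity is `1` and
  -- the factorial remains.
  have h1 := congrArg (fun lam => lam (delta (φ 1))) h
  simp only [_root_.smul_apply, prodFunctional_apply hφ, _root_.zero_apply, Finset.prod_empty,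
    smul_eq_mul, mul_one] at h1
  exact Nat.cast_ne_zero.2 (Nat.factorial_ne_zero _) h1.symm

end Nonvanishing

/-! ### Nilpotent ideals, the Jacobson radical and Baire category -/

section Radical

/-- Each `a * x + 1` is a unit, being a nilpotent perturbation of `1`; this is left
quasi-regularity. -/
theorem mem_jacobson_of_forall_isNilpotent {R : Type*} [Ring R] {x : R}
    (h : ∀ a : R, IsNilpotent (a * x)) : x ∈ Ring.jacobson R := by
  rw [← Ideal.jacobson_bot, Ideal.mem_jacobson_iff]
  intro y
  obtain ⟨u, hu⟩ := (h y).isUnit_add_one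
  refine ⟨↑u⁻¹, ?_⟩
  have : (↑u⁻¹ : R) * y * x + ↑u⁻¹ = ↑u⁻¹ * (u : R) := by rw [hu]; noncomm_ring
  rw [this, Units.inv_mul, sub_self]
  exact zero_mem _

theorem isClosed_jacobson (R : Type*) [NormedRing R] [HasSummableGeomSeries R] :
    IsClosed (Ring.jacobson R : Set R) := by
  rw [Ring.jacobson_eq_sInf_isMaximal, Submodule.coe_sInf]
  refine isClosed_biInter fun I hI => ?_
  have : Ideal.IsMaximal (α := R) I := hI
  exact Ideal.IsMaximal.isClosed (hI := this)

/-- A Banach algebra in whose radical there is no bound on the order of nilpotence of the nilpotent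
elements has a non-nilpotent element in its radical. -/
theorem exists_mem_jacobson_not_isNilpotent {B : Type*} [NormedRing B] [NormedAlgebra ℂ B]
    [CompleteSpace B] (h : ∀ n : ℕ, ∃ x ∈ Ring.jacobson B, x ^ n ≠ 0) :
    ∃ x ∈ Ring.jacobson B, ¬ IsNilpotent x := by
  by_contra! hnil
  have hcl := isClosed_jacobson B
  have : CompleteSpace (Ring.jacobson B) := hcl.completeSpace_coe
  -- If every element of the radical were nilpotent, the closed sets `x ^ n = 0` would cover a
  -- complete space, so one of them has an interior point `x₀`.
  obtain ⟨n, x₀, hx₀⟩ := nonempty_interior_of_iUnion_of_closed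
    (f := fun n : ℕ => {x : Ring.jacobson B | (x : B) ^ n = 0})
    (fun n => isClosed_eq (by fun_prop) continuous_const)
    (Set.eq_univ_of_forall fun x => Set.mem_iUnion.2 (hnil x x.2))
  obtain ⟨y, hy, hyn⟩ := h n
  refine hyn ?_
  have hmem : ∀ t : ℂ, (x₀ : B) + t • y ∈ Ring.jacobson B := fun t =>
    add_mem x₀.2 (by rw [← smul_one_mul]; exact (Ring.jacobson B).mul_mem_left _ hy)
  have hc : Continuous fun t : ℂ => (⟨(x₀ : B) + t • y, hmem t⟩ : Ring.jacobson B) := by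
    fun_prop
  have hev : ∀ᶠ t : ℂ in nhds 0, ((x₀ : B) + t • y) ^ n = 0 := by
    have h0 : (⟨(x₀ : B) + (0 : ℂ) • y, hmem 0⟩ : Ring.jacobson B) = x₀ := by simp
    refine (hc.tendsto 0).eventually (p := fun x : Ring.jacobson B => (x : B) ^ n = 0) ?_
    rw [h0]
    exact mem_interior_iff_mem_nhds.1 hx₀
  -- The polynomial `(x₀ + t y) ^ n` vanishes near `t = 0`, hence for all `t`. Rescaling by `s =
  -- t⁻¹` and letting `s → 0` isolates the top coefficient `y ^ n`.
  have han : AnalyticOnNhd ℂ (fun t : ℂ => ((x₀ : B) + t • y) ^ n) Set.univ := fun t _ =>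
    (analyticAt_const.add (analyticAt_id.smul analyticAt_const)).pow n
  have hall : ∀ t : ℂ, ((x₀ : B) + t • y) ^ n = 0 := fun t =>
    congrFun (han.eq_of_eventuallyEq (g := fun _ => (0 : B)) analyticOnNhd_const hev) t
  have hs : ∀ s : ℂ, s ≠ 0 → (s • (x₀ : B) + y) ^ n = 0 := fun s hs => by
    have : s • (x₀ : B) + y = s • ((x₀ : B) + s⁻¹ • y) := by
      rw [smul_add, smul_inv_smul₀ hs]
    rw [this, smul_pow, hall, smul_zero]
  have hlim : Filter.Tendsto (fun s : ℂ => (s • (x₀ : B) + y) ^ n) (nhdsWithin 0 {0}ᶜ)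
      (nhds (((0 : ℂ) • (x₀ : B) + y) ^ n)) :=
    Filter.Tendsto.mono_left (Continuous.tendsto (by fun_prop) _) nhdsWithin_le_nhds
  have hlim' : Filter.Tendsto (fun s : ℂ => (s • (x₀ : B) + y) ^ n) (nhdsWithin 0 {0}ᶜ)
      (nhds 0) :=
    tendsto_const_nhds.congr' (by
      filter_upwards [self_mem_nhdsWithin] with s h using (hs s h).symm)
  simpa using tendsto_nhds_unique hlim hlim'

variable {G ι : Type*} [Group G] [Fintype ι]

theorem leftIdealSpan_le_jacobson {L : ι → Subgroup G} (hL : IsPermutedFamily L)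
    {Γ : ∀ j, Bidual (Ell1 (L j))} (hΓ : ∀ j, IsInvariantDifference (Γ j))
    {x : Bidual (Ell1 G)} (hx : x ∈ leftIdealSpan (fun j => Bidual.map (incl (L j)) (Γ j))) :
    x ∈ Ring.jacobson (Bidual (Ell1 G)) :=
  mem_jacobson_of_forall_isNilpotent fun a => ⟨Fintype.card ι + 1, by
    have := Submodule.pow_mem_pow _ (mul_mem_leftIdealSpan a hx) (Fintype.card ι + 1)
    rwa [hL.leftIdealSpan_pow_eq_bot hΓ, Submodule.mem_bot] at this⟩

theorem exists_isNilpotentOfIndex {L : ι → Subgroup G} (hL : IsPermutedFamily L)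
    {Γ : ∀ j, Bidual (Ell1 (L j))} (hΓ : ∀ j, IsInvariantDifference (Γ j))
    (hΓ0 : ∀ j, Γ j ≠ 0) :
    ∃ n ≥ Fintype.card ι,
      IsNilpotentOfIndex (leftIdealSpan (fun j => Bidual.map (incl (L j)) (Γ j))) n := by
  classical
  have hex : ∃ n : ℕ, 1 ≤ n ∧ leftIdealSpan (fun j => Bidual.map (incl (L j)) (Γ j)) ^ n = ⊥ :=
    ⟨_, Nat.le_add_left 1 _, hL.leftIdealSpan_pow_eq_bot hΓ⟩
  refine ⟨Nat.find hex, ?_, Nat.find_spec hex, fun m hm => Nat.find_min' hex hm⟩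
  -- A smaller index would annihilate the `k`-th power of the sum of the generators.
  by_contra! hlt
  have h := Submodule.pow_mem_pow _
    (sum_mem_leftIdealSpan fun j => Bidual.map (incl (L j)) (Γ j)) (Nat.find hex)
  rw [(Nat.find_spec hex).2, Submodule.mem_bot] at h
  exact hL.sum_pow_ne_zero hΓ hΓ0 (pow_eq_zero_of_le hlt.le h)

end Radical

/-! ### Thick sets with thick complement -/

section Thick

/-- A set is (left) thick if it contains a right translate `F s` of each finite set `F`. -/
def IsThick {G : Type*} [Group G] (A : Set G) : Prop :=
  ∀ F : Finset G, ∃ s, ∀ t ∈ F, t * s ∈ A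

theorem exists_disjoint_translate {G : Type*} [Group G] [Infinite G] (F U : Finset G) :
    ∃ s, ∀ t ∈ F, t * s ∉ U := by
  classical
  obtain ⟨s, hs⟩ := Infinite.exists_notMem_finset (Finset.image₂ (fun t u => t⁻¹ * u) F U)
  exact ⟨s, fun t ht htU => hs (Finset.mem_image₂.2 ⟨t, ht, t * s, htU, by group⟩)⟩

/-- Enumerate the pairs of a finite set and a label, and choose successively pairwise disjoint right
translates of the finite sets. The translates labelled `true` make up the set; those labelled
`false` lie in its complement. -/
theorem exists_isThick_of_countable (G : Type*) [Group G] [Infinite G] [Countable G] :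
    ∃ A : Set G, IsThick A ∧ IsThick Aᶜ := by
  classical
  obtain ⟨e, he⟩ := exists_surjective_nat (Finset G × Bool)
  choose s hs using exists_disjoint_translate (G := G)
  -- `U n` is the union of the translates chosen before stage `n`; the next one has to avoid it.
  let U : ℕ → Finset G := fun n =>
    Nat.rec ∅ (fun n V => V ∪ (e n).1.image (· * s (e n).1 V)) n
  have hU : ∀ n, U (n + 1) = U n ∪ (e n).1.image (· * s (e n).1 (U n)) := fun n => rfl
  have hmono : Monotone U := monotone_nat_of_le_succ fun n => by
    rw [hU]
    exact Finset.subset_union_left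
  have hmem : ∀ n, ∀ t ∈ (e n).1, t * s (e n).1 (U n) ∈ U (n + 1) := fun n t ht => by
    rw [hU]
    exact Finset.mem_union_right _ (Finset.mem_image_of_mem _ ht)
  have hdisj : ∀ m n, ∀ t ∈ (e m).1, ∀ u ∈ (e n).1,
      t * s (e m).1 (U m) = u * s (e n).1 (U n) → m = n := by
    intro m n t ht u hu h
    rcases lt_trichotomy m n with hmn | hmn | hmn
    · exact absurd (h ▸ hmono hmn (hmem m t ht)) (hs _ _ u hu)
    · exact hmn
    · exact absurd (h ▸ hmono hmn (hmem n u hu)) (hs _ _ t ht)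
  refine ⟨{g | ∃ n, (e n).2 = true ∧ ∃ t ∈ (e n).1, t * s (e n).1 (U n) = g},
    fun F => ?_, fun F => ?_⟩
  · obtain ⟨n, hn⟩ := he (F, true)
    exact ⟨s (e n).1 (U n), fun t ht => ⟨n, by rw [hn], t, by rwa [hn], rfl⟩⟩
  · obtain ⟨n, hn⟩ := he (F, false)
    refine ⟨s (e n).1 (U n), fun t ht => ?_⟩
    rintro ⟨m, hm, u, hu, h⟩
    obtain rfl := hdisj m n u hu t (by rwa [hn]) h
    rw [hn] at hm
    exact Bool.false_ne_true hm

/-- A group retracts onto each of its subgroups `C`, equivariantly for right translations by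
elements of `C`. -/
theorem Subgroup.exists_equivariant_right {G : Type*} [Group G] (C : Subgroup G) :
    ∃ c : G → C, ∀ (g : G) (s : C), c (g * s) = c g * s := by
  have hmem : ∀ g : G, (QuotientGroup.mk (s := C) g).out⁻¹ * g ∈ C := fun g =>
    QuotientGroup.eq.1 (QuotientGroup.out_eq' _)
  refine ⟨fun g => ⟨_, hmem g⟩, fun g s => Subtype.ext ?_⟩
  change (QuotientGroup.mk (s := C) (g * s)).out⁻¹ * (g * s) =
    (QuotientGroup.mk (s := C) g).out⁻¹ * g * s
  rw [QuotientGroup.mk_mul_of_mem g s.2, mul_assoc]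

theorem Subgroup.exists_equivariant_left {G : Type*} [Group G] (C : Subgroup G) :
    ∃ c : G → C, ∀ (s : C) (g : G), c (s * g) = s * c g := by
  obtain ⟨c, hc⟩ := C.exists_equivariant_right
  refine ⟨fun g => (c g⁻¹)⁻¹, fun s g => ?_⟩
  change (c (s * g)⁻¹)⁻¹ = s * (c g⁻¹)⁻¹
  rw [mul_inv_rev, ← Subgroup.coe_inv, hc, mul_inv_rev, inv_inv]

theorem exists_countable_infinite_subgroup (G : Type*) [Group G] [Infinite G] :
    ∃ C : Subgroup G, Countable C ∧ Infinite C := by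
  have : Countable (FreeGroup ℕ) := inferInstanceAs (Countable (Quot _))
  let f : FreeGroup ℕ →* G := FreeGroup.lift (Infinite.natEmbedding G)
  refine ⟨f.range, (Set.countable_range f).to_subtype, ?_⟩
  refine Infinite.of_injective
    (fun n => (⟨Infinite.natEmbedding G n, FreeGroup.of n, by simp [f]⟩ : f.range)) fun m n h => ?_
  exact (Infinite.natEmbedding G).injective (Subtype.ext_iff.1 h)

/-- Thickness pulls back along a right-equivariant retraction onto a countable infinite subgroup: a
translating element found for `c(F)` also works for `F`. -/
theorem exists_isThick (G : Type*) [Group G] [Infinite G] :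
    ∃ A : Set G, IsThick A ∧ IsThick Aᶜ := by
  classical
  obtain ⟨C, _, _⟩ := exists_countable_infinite_subgroup G
  obtain ⟨A, hA, hA'⟩ := exists_isThick_of_countable C
  obtain ⟨c, hc⟩ := C.exists_equivariant_right
  have key : ∀ B : Set C, IsThick B → IsThick (c ⁻¹' B) := fun B hB F => by
    obtain ⟨s, hs⟩ := hB (F.image c)
    refine ⟨s, fun t ht => ?_⟩
    rw [Set.mem_preimage, hc]
    exact hs _ (Finset.mem_image_of_mem c ht)
  exact ⟨c ⁻¹' A, key A hA, key Aᶜ hA'⟩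

end Thick

/-! ### Existence of invariant means and nonzero invariant differences -/

section Difference

variable {G : Type*} [Group G]

open Classical in
/-- The indicator function of a set, as an element of `ℓ^∞(G)`. -/
def indicatorFunctional (A : Set G) : StrongDual ℂ (Ell1 G) :=
  lift (fun g => if g ∈ A then 1 else 0) 1 fun g => by split_ifs <;> simp

open Classical in
theorem indicatorFunctional_delta (A : Set G) (g : G) :
    indicatorFunctional A (delta g) = if g ∈ A then 1 else 0 := lift_delta _ _ _ _

/-- A thick set carries an element of the second dual at which all its translates are one. -/
theorem IsThick.exists_limit {A : Set G} (hA : IsThick A) :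
    ∃ Φ : Bidual (Ell1 G), Φ (sumCLM G) = 1 ∧
      ∀ (c : ℂ) (lam : StrongDual ℂ (Ell1 G)), (∀ g ∈ A, lam (delta g) = c) →
        bidualAct Φ lam = c • sumCLM G := by
  choose s hs using hA
  obtain ⟨Φ, hΦ⟩ := Bidual.exists_limit (Ultrafilter.of (Filter.atTop : Filter (Finset G)))
    (fun F => delta (s F)) (fun F => (norm_delta (s F)).le)
  refine ⟨Φ, ?_, fun c lam hlam => clm_ext fun t => ?_⟩
  · refine tendsto_nhds_unique (hΦ (sumCLM G)) ?_
    simp only [sumCLM_delta]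
    exact tendsto_const_nhds
  · refine tendsto_nhds_unique (hΦ (dualAct lam (delta t))) ?_
    rw [_root_.smul_apply, sumCLM_delta, smul_eq_mul, mul_one]
    refine tendsto_const_nhds.congr' ?_
    -- Each fixed `t` eventually belongs to `F`, and from then on `t * s F` lies in `A`.
    have hle := Ultrafilter.of_le (Filter.atTop : Filter (Finset G))
    filter_upwards [hle (Filter.eventually_ge_atTop {t})] with F hF
    rw [dualAct_apply, delta_mul_delta, hlam _ (hs F t (hF (Finset.mem_singleton_self t)))]

/-- An infinite group with a nonzero invariant mean has a nonzero invariant difference. -/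
theorem exists_isInvariantDifference_ne_zero [Infinite G] {M : Bidual (Ell1 G)}
    (hM : IsLeftInvariant M) (hM1 : M (sumCLM G) = 1) :
    ∃ Γ : Bidual (Ell1 G), IsInvariantDifference Γ ∧ Γ ≠ 0 := by
  obtain ⟨A, hA, hA'⟩ := exists_isThick G
  obtain ⟨Φ, hΦ1, hΦ⟩ := hA.exists_limit
  obtain ⟨Ψ, hΨ1, hΨ⟩ := hA'.exists_limit
  -- `Φ` and `Ψ` both have mass `1`, so the difference kills constants; on the indicator of `A` they
  -- produce the constants `1` and `0`, so `M * (Φ - Ψ)` takes the value `1` there.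
  refine ⟨M * (Φ - Ψ), ⟨hM.mul _, ?_⟩, fun h => ?_⟩
  · rw [Bidual.mul_apply, bidualAct_sumCLM, Bidual.sub_apply, hΦ1, hΨ1, sub_self, map_smul,
      zero_smul]
  · have h1 : (M * (Φ - Ψ)) (indicatorFunctional A) = 0 := by rw [h]; rfl
    rw [mul_sub, Bidual.sub_apply, Bidual.mul_apply, Bidual.mul_apply,
      hΦ 1 _ fun g hg => by rw [indicatorFunctional_delta, if_pos hg],
      hΨ 0 _ fun g hg => by rw [indicatorFunctional_delta, if_neg hg], one_smul, map_smul, hM1,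
      zero_smul, sub_zero] at h1
    exact one_ne_zero h1

/-- Restriction of an invariant mean to a subgroup. -/
theorem IsLeftInvariant.exists_subgroup {M : Bidual (Ell1 G)} (hM : IsLeftInvariant M)
    (hM1 : M (sumCLM G) = 1) (H : Subgroup G) :
    ∃ N : Bidual (Ell1 H), IsLeftInvariant N ∧ N (sumCLM H) = 1 := by
  obtain ⟨c, hc⟩ := H.exists_equivariant_left
  refine ⟨Bidual.map (push c) M, isLeftInvariant_iff.2 fun s lam => ?_, ?_⟩
  · rw [Bidual.map_apply, Bidual.map_apply, ← isLeftInvariant_iff.1 hM s (lam.comp (push c))]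
    congr 1
    refine clm_ext fun g => ?_
    simp [hc]
  · rw [Bidual.map_apply, ← hM1]
    congr 1
    refine clm_ext fun g => ?_
    rw [ContinuousLinearMap.comp_apply, push_delta, sumCLM_delta, sumCLM_delta]

/-- Cyclic groups have invariant means. -/
theorem exists_isLeftInvariant_of_cyclic (z : G) (hz : ∀ g, g ∈ Subgroup.zpowers z) :
    ∃ M : Bidual (Ell1 G), IsLeftInvariant M ∧ M (sumCLM G) = 1 := by
  -- Averages over `1, z, …, zⁿ`: translation by `z` changes only the two end terms, so a limit
  -- along a free ultrafilter is invariant under `z`.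
  let a : ℕ → Ell1 G := fun n => ((n : ℂ) + 1)⁻¹ • ∑ i ∈ Finset.range (n + 1), delta (z ^ i)
  have hn : ∀ n : ℕ, ‖(n : ℂ) + 1‖ = n + 1 := fun n => by
    exact_mod_cast Complex.norm_natCast (n + 1)
  have hn0 : ∀ n : ℕ, (n : ℂ) + 1 ≠ 0 := fun n => Nat.cast_add_one_ne_zero n
  have ha : ∀ n, ‖a n‖ ≤ 1 := fun n => by
    rw [norm_smul, norm_inv, hn, inv_mul_le_iff₀ (by positivity), mul_one]
    refine (norm_sum_le _ _).trans ?_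
    simp [norm_delta]
  let U := Filter.hyperfilter ℕ
  obtain ⟨M, hM⟩ := Bidual.exists_limit U a ha
  have hU : (U : Filter ℕ) ≤ Filter.atTop := Nat.hyperfilter_le_atTop
  have hzM : ∀ lam, M (dualAct lam (delta z)) = M lam := fun lam => by
    refine sub_eq_zero.1 (tendsto_nhds_unique ((hM (dualAct lam (delta z))).sub (hM lam)) ?_)
    refine Filter.Tendsto.mono_left ?_ hU
    have h0 : Filter.Tendsto (fun n : ℕ => 2 * ‖lam‖ * (1 / ((n : ℝ) + 1))) Filter.atTop
        (nhds 0) := by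
      simpa using tendsto_one_div_add_atTop_nhds_zero_nat.const_mul (2 * ‖lam‖)
    refine squeeze_zero_norm (fun n => ?_) h0
    have hdiff : dualAct lam (delta z) (a n) - lam (a n) =
        ((n : ℂ) + 1)⁻¹ * (lam (delta (z ^ (n + 1))) - lam (delta 1)) := by
      simp only [a, map_smul, map_sum, dualAct_apply, delta_mul_delta, ← pow_succ', smul_eq_mul]
      rw [← mul_sub, ← Finset.sum_sub_distrib,
        Finset.sum_range_sub (fun i => lam (delta (z ^ i))), pow_zero]
    have hb : ∀ g : G, ‖lam (delta g)‖ ≤ ‖lam‖ := fun g =>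
      (lam.le_opNorm _).trans (by rw [norm_delta, mul_one])
    rw [hdiff, norm_mul, norm_inv, hn, mul_comm, one_div]
    refine mul_le_mul_of_nonneg_right ?_ (by positivity)
    exact (norm_sub_le _ _).trans (by linarith [hb (z ^ (n + 1)), hb 1])
  -- The elements fixing `M` form a subgroup, so invariance under the generator suffices.
  let S : Subgroup G :=
    { carrier := {s | ∀ lam, M (dualAct lam (delta s)) = M lam}
      mul_mem' := fun {s t} hs ht lam => by
        rw [← delta_mul_delta, ← dualAct_dualAct, ht, hs]
      one_mem' := fun lam => by
        congr 1
        refine clm_ext fun t => ?_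
        simp
      inv_mem' := fun {s} hs lam => by
        rw [← hs, dualAct_dualAct, delta_mul_delta, inv_mul_cancel]
        congr 1
        refine clm_ext fun t => ?_
        simp }
  refine ⟨M, isLeftInvariant_iff.2 fun s lam => ?_, ?_⟩
  · exact (Subgroup.zpowers_le (H := S)).2 hzM (hz s) lam
  · refine tendsto_nhds_unique (hM (sumCLM G)) ?_
    refine tendsto_const_nhds.congr fun n => ?_
    simp only [a, map_smul, map_sum, sumCLM_delta, smul_eq_mul, Finset.sum_const,
      Finset.card_range, nsmul_eq_mul, mul_one]
    push_cast
    rw [inv_mul_cancel₀ (hn0 n)]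

end Difference

/-! ### A finitely generated group with centre of infinite rank -/

section Hall

open LaurentPolynomial

/-- The group of matrices `(1, a, b; 0, Tⁿ, c; 0, 0, 1)` over the ring of integral Laurent
polynomials; it contains P. Hall's finitely generated solvable groups with centre of infinite
rank. -/
@[ext]
structure HallGroup where
  n : ℤ
  a : ℤ[T;T⁻¹]
  b : ℤ[T;T⁻¹]
  c : ℤ[T;T⁻¹]

namespace HallGroup

instance : Mul HallGroup :=
  ⟨fun x y => ⟨x.n + y.n, y.a + x.a * T y.n, y.b + x.a * y.c + x.b, T x.n * y.c + x.c⟩⟩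

instance : One HallGroup := ⟨⟨0, 0, 0, 0⟩⟩

instance : Inv HallGroup :=
  ⟨fun x => ⟨-x.n, -(x.a * T (-x.n)), x.a * T (-x.n) * x.c - x.b, -(T (-x.n) * x.c)⟩⟩

@[simp] theorem mul_n (x y : HallGroup) : (x * y).n = x.n + y.n := rfl
@[simp] theorem mul_a (x y : HallGroup) : (x * y).a = y.a + x.a * T y.n := rfl
@[simp] theorem mul_b (x y : HallGroup) : (x * y).b = y.b + x.a * y.c + x.b := rfl
@[simp] theorem mul_c (x y : HallGroup) : (x * y).c = T x.n * y.c + x.c := rfl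
@[simp] theorem one_n : (1 : HallGroup).n = 0 := rfl
@[simp] theorem one_a : (1 : HallGroup).a = 0 := rfl
@[simp] theorem one_b : (1 : HallGroup).b = 0 := rfl
@[simp] theorem one_c : (1 : HallGroup).c = 0 := rfl
@[simp] theorem inv_n (x : HallGroup) : x⁻¹.n = -x.n := rfl
@[simp] theorem inv_a (x : HallGroup) : x⁻¹.a = -(x.a * T (-x.n)) := rfl
@[simp] theorem inv_b (x : HallGroup) : x⁻¹.b = x.a * T (-x.n) * x.c - x.b := rfl
@[simp] theorem inv_c (x : HallGroup) : x⁻¹.c = -(T (-x.n) * x.c) := rfl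

instance : Group HallGroup :=
  Group.ofLeftAxioms
    (fun x y z => by
      ext1
      · simp [add_assoc]
      · simp only [mul_a, mul_n, T_add]; ring
      · simp only [mul_a, mul_b, mul_c]; ring
      · simp only [mul_c, mul_n, T_add]; ring)
    (fun x => by ext1 <;> simp)
    (fun x => by
      have h : (T (-x.n) : ℤ[T;T⁻¹]) * T x.n = 1 := by rw [← T_add, neg_add_cancel, T_zero]
      ext1
      · simp
      · simp only [mul_a, inv_a, one_a]; linear_combination -x.a * h
      · simp only [mul_b, inv_a, inv_b, one_b]; ring
      · simp only [mul_c, inv_c, inv_n, one_c]; ring)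

/-- The central elements of the group, as a homomorphic image of the ring. -/
def central : Multiplicative ℤ[T;T⁻¹] →* HallGroup where
  toFun r := ⟨0, 0, r.toAdd, 0⟩
  map_one' := rfl
  map_mul' r s := by ext1 <;> simp [add_comm]

/-- The diagonal elements of the group. -/
def diagonal : Multiplicative ℤ →* HallGroup where
  toFun n := ⟨n.toAdd, 0, 0, 0⟩
  map_one' := rfl
  map_mul' m n := by ext1 <;> simp

theorem central_commute (r : Multiplicative ℤ[T;T⁻¹]) (x : HallGroup) :
    central r * x = x * central r := by
  ext1 <;> simp [central, add_comm]

/-- The subgroup generated by `T`, `E₁₂` and `E₂₃`. -/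
def gen : Subgroup HallGroup :=
  Subgroup.closure {⟨1, 0, 0, 0⟩, ⟨0, 1, 0, 0⟩, ⟨0, 0, 0, 1⟩}

theorem fg_gen : Group.FG gen :=
  Group.closure_finite_fg _

/-- Conjugating `E₁₂` by powers of the diagonal generator gives `1 + Tⁿ E₁₂`, whose commutator with
`1 + E₂₃` is `1 + Tⁿ E₁₃`. -/
theorem central_mem_gen (n : ℤ) : central (Multiplicative.ofAdd (T n)) ∈ gen := by
  have hd : ∀ m : ℤ, diagonal (Multiplicative.ofAdd m) ∈ gen := fun m => by
    have : Multiplicative.ofAdd m = Multiplicative.ofAdd 1 ^ m := by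
      rw [← ofAdd_zsmul, smul_eq_mul, mul_one]
    rw [this, map_zpow]
    have h1 : (⟨1, 0, 0, 0⟩ : HallGroup) ∈ gen := Subgroup.subset_closure (by simp)
    exact Subgroup.zpow_mem _ h1 m
  have ha : (⟨0, 1, 0, 0⟩ : HallGroup) ∈ gen := Subgroup.subset_closure (by simp)
  have hc : (⟨0, 0, 0, 1⟩ : HallGroup) ∈ gen := Subgroup.subset_closure (by simp)
  have ha' : (⟨0, T n, 0, 0⟩ : HallGroup) ∈ gen := by
    have h := mul_mem (hd (-n)) (mul_mem ha (hd n))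
    convert h using 1
    ext1 <;> simp [diagonal]
  -- The commutator is written as `(x y) (y x)⁻¹`, so that cancelling leaves an identity without
  -- inverses.
  have h : central (Multiplicative.ofAdd (T n)) =
      (⟨0, T n, 0, 0⟩ * ⟨0, 0, 0, 1⟩) * (⟨0, 0, 0, 1⟩ * ⟨0, T n, 0, 0⟩ : HallGroup)⁻¹ := by
    rw [eq_mul_inv_iff_mul_eq]
    ext1 <;> simp [central]
  rw [h]
  exact mul_mem (mul_mem ha' hc) (inv_mem (mul_mem hc ha'))

/-- The central element `1 + Tⁿ E₁₃`. -/
def centralElement (n : ℤ) : gen := ⟨central (Multiplicative.ofAdd (T n)), central_mem_gen n⟩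

theorem coe_centralElement_zpow (n m : ℤ) :
    ((centralElement n ^ m : gen) : HallGroup) = ⟨0, 0, m • T n, 0⟩ := by
  rw [Subgroup.coe_zpow]
  change central (Multiplicative.ofAdd (T n)) ^ m = _
  rw [← map_zpow, ← ofAdd_zsmul]
  rfl

theorem coeff_zpow_centralElement (n m : ℤ) :
    ((centralElement n ^ m : gen) : HallGroup).b.coeff n = m := by
  rw [coe_centralElement_zpow]
  change (m • (T n : ℤ[T;T⁻¹])).coeff n = m
  rw [AddMonoidAlgebra.coeff_smul, Finsupp.smul_apply, T_apply, if_pos rfl, smul_eq_mul, mul_one]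

theorem centralElement_zpow_injective (n : ℤ) :
    Function.Injective fun m : ℤ => centralElement n ^ m := fun m m' h => by
  have h' := congrArg (fun x : gen => (x : HallGroup).b.coeff n) h
  exact (coeff_zpow_centralElement n m).symm.trans (h'.trans (coeff_zpow_centralElement n m'))

/-- The elements `1 + b E₁₃` such that `Tⁿ` does not occur in `b`. -/
def coeffZero (n : ℤ) : Subgroup HallGroup where
  carrier := {x | x.a = 0 ∧ x.c = 0 ∧ x.b.coeff n = 0}
  mul_mem' := fun {x y} hx hy => by
    refine ⟨?_, ?_, ?_⟩ <;> simp [hx.1, hx.2.1, hx.2.2, hy.1, hy.2.1, hy.2.2]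
  one_mem' := ⟨rfl, rfl, rfl⟩
  inv_mem' := fun {x} hx => by
    refine ⟨?_, ?_, ?_⟩ <;> simp [hx.1, hx.2.1, hx.2.2]

/-- The coefficient of `Tⁿ` in the corner entry separates: it is the exponent on the `n`-th cyclic
group and vanishes on the subgroup generated by the others. -/
theorem iSupIndep_zpowers_centralElement :
    iSupIndep fun n : ℤ => Subgroup.zpowers (centralElement n) := by
  intro n
  refine Subgroup.disjoint_def.2 fun {x} hx hx' => ?_
  have hle : ⨆ (j) (_ : j ≠ n), Subgroup.zpowers (centralElement j) ≤
      (coeffZero n).comap gen.subtype := iSup₂_le fun j hj => by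
    rw [Subgroup.zpowers_le]
    refine ⟨rfl, rfl, ?_⟩
    change (T j : ℤ[T;T⁻¹]).coeff n = 0
    rw [T_apply, if_neg hj]
  obtain ⟨m, rfl⟩ := Subgroup.mem_zpowers_iff.1 hx
  have h := (hle hx').2.2
  change ((centralElement n ^ m : gen) : HallGroup).b.coeff n = 0 at h
  rw [coeff_zpow_centralElement] at h
  rw [h, zpow_zero]

end HallGroup

end Hall

/-! ### From large families to non-nilpotent radical elements -/

section Central

variable {G ι : Type*} [Group G]

theorem IsPermutedFamily.of_le_center {L : ι → Subgroup G} (hc : ∀ j, L j ≤ Subgroup.center G)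
    (hL : _root_.iSupIndep L) (h0 : ∀ j, L j ≠ ⊥) : IsPermutedFamily L where
  commute i j _ x hx y _ := (Subgroup.mem_center_iff.1 (hc i hx) y).symm
  iSupIndep := hL
  injective := hL.injective h0
  conj g j := ⟨j, by
    have h : ∀ x ∈ L j, MulAut.conj g x = x := fun x hx => by
      rw [MulAut.conj_apply, Subgroup.mem_center_iff.1 (hc j hx) g, mul_inv_cancel_right]
    ext x
    constructor
    · rintro ⟨y, hy, rfl⟩
      change MulAut.conj g y ∈ L j
      rwa [h y hy]
    · exact fun hx => ⟨x, hx, h x hx⟩⟩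

/-- If `G` contains arbitrarily large permuted families of subgroups with nonzero invariant
differences, then the radical of `ℓ¹(G)^{**}` contains a non-nilpotent element. -/
theorem exists_mem_jacobson_not_isNilpotent_of_families
    (h : ∀ N : ℕ, ∃ n ≥ N, ∃ L : Fin n → Subgroup G, IsPermutedFamily L ∧
      ∀ j, ∃ Γ : Bidual (Ell1 (L j)), IsInvariantDifference Γ ∧ Γ ≠ 0) :
    ∃ x ∈ Ring.jacobson (Bidual (Ell1 G)), ¬ IsNilpotent x := by
  refine exists_mem_jacobson_not_isNilpotent fun N => ?_
  obtain ⟨n, hn, L, hL, hΓ⟩ := h N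
  choose Γ hΓ hΓ0 using hΓ
  refine ⟨_, leftIdealSpan_le_jacobson hL hΓ (sum_mem_leftIdealSpan _), fun h0 => ?_⟩
  refine hL.sum_pow_ne_zero hΓ hΓ0 (pow_eq_zero_of_le ?_ h0)
  rwa [Fintype.card_fin]

end Central

/-- Central subgroups are fixed by conjugation, so any `N` of the independent infinite cyclic ones
form a permuted family. Only these cyclic groups need invariant means, not the whole group. -/
theorem HallGroup.exists_mem_jacobson_not_isNilpotent :
    ∃ x ∈ Ring.jacobson (Bidual (Ell1 HallGroup.gen)), ¬ IsNilpotent x := by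
  refine exists_mem_jacobson_not_isNilpotent_of_families fun N => ⟨N, le_rfl,
    fun j => Subgroup.zpowers (centralElement (j : ℕ)), ?_, fun j => ?_⟩
  · refine IsPermutedFamily.of_le_center (fun j => ?_) ?_ fun j => ?_
    · rw [Subgroup.zpowers_le, Subgroup.mem_center_iff]
      exact fun g => Subtype.ext (central_commute _ _).symm
    · exact iSupIndep_zpowers_centralElement.comp (f := fun j : Fin N => ((j : ℕ) : ℤ))
        fun i j hij => Fin.ext (Int.ofNat_inj.1 hij)
    · rw [Ne, Subgroup.zpowers_eq_bot]
      intro h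
      have := @centralElement_zpow_injective (j : ℕ) 1 0 (by simp [h])
      exact one_ne_zero this
  · have : Infinite (Subgroup.zpowers (centralElement (j : ℕ))) :=
      Infinite.of_injective (fun m : ℤ => ⟨centralElement (j : ℕ) ^ m, m, rfl⟩) fun m m' h =>
        centralElement_zpow_injective _ (Subtype.ext_iff.1 h)
    obtain ⟨M, hM, hM1⟩ := exists_isLeftInvariant_of_cyclic
      (⟨centralElement (j : ℕ), Subgroup.mem_zpowers _⟩ :
        Subgroup.zpowers (centralElement (j : ℕ))) (by
      rintro ⟨g, m, rfl⟩
      exact ⟨m, Subtype.ext rfl⟩)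
    exact exists_isInvariantDifference_ne_zero hM hM1

/-! ### Application to branch groups -/

namespace BranchStructure

variable {G : Type*} [Group G] (B : BranchStructure G)

theorem two_pow_le_k (i : ℕ) : 2 ^ i ≤ B.k i := by
  induction i with
  | zero => exact B.k_pos 0
  | succ i ih =>
    obtain ⟨m, hm, hk, -⟩ := B.refines i
    rw [hk, pow_succ]
    exact Nat.mul_le_mul ih hm

/-- The factors of `H i` are all isomorphic, so one finite factor would make the product `H i`
finite, and then `G`, in which it has finite index. -/
theorem infinite_factor [Infinite G] (i : ℕ) (j : Fin (B.k i)) : Infinite (B.factor i j) := by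
  by_contra hfin
  rw [not_infinite_iff_finite] at hfin
  obtain ⟨e⟩ := B.factor_iso i j
  have hL : Finite (B.L i) := Finite.of_equiv _ e.toEquiv
  have hall : ∀ l, Finite (B.factor i l) := fun l =>
    Finite.of_equiv _ (B.factor_iso i l).some.symm.toEquiv
  obtain ⟨hcomm, -, hsup⟩ := B.isDirectProduct i
  have hcomm' : Pairwise fun l m : Fin (B.k i) =>
      ∀ x y : G, x ∈ B.factor i l → y ∈ B.factor i m → Commute x y :=
    fun l m hlm x y hx hy => hcomm l m hlm x hx y hy
  have hH : Finite (B.H i) := by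
    rw [← hsup, ← Subgroup.noncommPiCoprod_range (hcomm := hcomm')]
    exact (Set.finite_range (Subgroup.noncommPiCoprod hcomm')).to_subtype
  have := B.finiteIndex_H i
  have hG : Finite G := Finite.of_subgroup_quotient (B.H i)
  exact not_finite G

theorem isPermutedFamily [Infinite G] (i : ℕ) : IsPermutedFamily (B.factor i) where
  commute := (B.isDirectProduct i).1
  iSupIndep := (B.isDirectProduct i).2.1
  injective := (B.isDirectProduct i).2.1.injective fun j hj => by
    have := B.infinite_factor i j
    rw [hj] at this
    exact not_finite (⊥ : Subgroup G)
  conj := B.conj_factor i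

/-- A factor is normalized by itself and centralized by the other factors, so it is normal in `H i`,
which is normal in `G`. -/
theorem isSubnormal_factor (i : ℕ) (j : Fin (B.k i)) : (B.factor i j).IsSubnormal := by
  obtain ⟨hcomm, -, hsup⟩ := B.isDirectProduct i
  have hle : B.factor i j ≤ B.H i := hsup ▸ le_iSup (B.factor i) j
  refine .step _ (B.H i) hle (B.normal_H i).isSubnormal ?_
  rw [Subgroup.normal_subgroupOf_iff_le_normalizer hle, ← hsup]
  refine iSup_le fun l => ?_
  by_cases hl : l = j
  · rw [hl]
    exact Subgroup.le_normalizer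
  · refine le_trans (fun x hx => ?_) (Subgroup.centralizer_le_normalizer _)
    exact Subgroup.mem_centralizer_iff.2 fun y hy => hcomm j l (Ne.symm hl) y hy x hx

theorem exists_isInvariantDifference_ne_zero [Infinite G] (hG : IsAmenable G) (i : ℕ)
    (j : Fin (B.k i)) :
    ∃ Γ : Bidual (Ell1 (B.factor i j)), IsInvariantDifference Γ ∧ Γ ≠ 0 := by
  obtain ⟨M, -, hM1, hM⟩ := hG
  obtain ⟨N, hN, hN1⟩ := hM.exists_subgroup hM1 (B.factor i j)
  have := B.infinite_factor i j
  exact _root_.exists_isInvariantDifference_ne_zero hN hN1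

theorem le_k (N : ℕ) : N ≤ B.k N := Nat.lt_two_pow_self.le.trans (B.two_pow_le_k N)

/-- Both `ℓ¹(G)^{**}` and `J_sn(G)` have nilpotent left ideals of arbitrarily large index. -/
theorem hasNilpotentLeftIdealsOfLargeIndex (B : BranchStructure G) [Infinite G]
    (hG : IsAmenable G)
    {A : Submodule ℂ (Bidual (Ell1 G))} (hA : Jsn G ≤ A) :
    HasNilpotentLeftIdealsOfLargeIndex (B := Bidual (Ell1 G)) A := by
  intro N
  choose Γ hΓ hΓ0 using B.exists_isInvariantDifference_ne_zero hG N
  obtain ⟨n, hn, hI⟩ := exists_isNilpotentOfIndex (B.isPermutedFamily N) hΓ hΓ0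
  rw [Fintype.card_fin] at hn
  refine ⟨n, (B.le_k N).trans hn, _, ⟨?_, fun a _ x hx => mul_mem_leftIdealSpan a hx⟩,
    ⟨le_top, fun a _ x hx => mul_mem_leftIdealSpan a hx⟩, hI⟩
  -- Subnormality of the factors makes every generator of the left ideal one of the elements
  -- spanning `Jsn G`.
  refine le_trans (Submodule.span_le.2 ?_) hA
  rintro x ⟨Φ, j, rfl⟩
  exact Submodule.subset_span ⟨Φ, _, Γ j, B.isSubnormal_factor N j, hΓ j, rfl⟩

end BranchStructure

end

theorem theorem1p2 :
    (∀ (G : Type*) [Group G] [Infinite G], IsAmenable G → IsBranchGroup G →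
      HasNilpotentLeftIdealsOfLargeIndex (B := Bidual (Ell1 G)) ⊤ ∧
      HasNilpotentLeftIdealsOfLargeIndex (B := Bidual (Ell1 G)) (Jsn G) ∧
      (∃ x ∈ Ring.jacobson (Bidual (Ell1 G)), ¬ IsNilpotent x) ∧
      (∃ x ∈ Ring.jacobson (Bidual (Ell1 G)), ∃ y ∈ Ring.jacobson (Bidual (Ell1 G)),
        x * y ≠ 0)) ∧
    (∃ (G : Type) (_ : Group G), Group.FG G ∧
      ∃ x ∈ Ring.jacobson (Bidual (Ell1 G)), ¬ IsNilpotent x) := by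
  refine ⟨fun G _ _ hG ⟨B⟩ => ?_, HallGroup.gen, inferInstance, HallGroup.fg_gen,
    HallGroup.exists_mem_jacobson_not_isNilpotent⟩
  have hnil : ∃ x ∈ Ring.jacobson (Bidual (Ell1 G)), ¬ IsNilpotent x :=
    exists_mem_jacobson_not_isNilpotent_of_families fun N =>
      ⟨B.k N, B.le_k N, B.factor N, B.isPermutedFamily N,
        B.exists_isInvariantDifference_ne_zero hG N⟩
  refine ⟨B.hasNilpotentLeftIdealsOfLargeIndex hG le_top,
    B.hasNilpotentLeftIdealsOfLargeIndex hG le_rfl, hnil, ?_⟩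
  obtain ⟨x, hx, hx0⟩ := hnil
  exact ⟨x, hx, x, hx, fun h => hx0 ⟨2, by rw [pow_two, h]⟩⟩
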